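/- All graphs are finite and simple. A \emph{snark} is a bridgeless cubic graph that has no proper $3$-edge-coloring. For a proper edge-coloring $\sigma$ of a graph and a vertex $v$, let $\sigma(v)$ be the set of colors of the edges at $v$. A proper edge-coloring $\sigma$ of a cubic graph is \emph{normal} if $|\sigma(u)\cup\sigma(v)|\in\{3,5\}$ for every edge $uv$; a normal $5$-edge-coloring is one that uses colors from a set of $5$ colors. A \emph{Petersen coloring} of a graph $G$ is a map $\phi:E(G)\to E(P_{10})$, where $P_{10}$ is the Petersen graph, such that for every $v\in V(G)$ there is $w\in V(P_{10})$ for which $\phi$ maps the set of edges at $v$ onto the set of edges at $w$. For odd $r\ge 5$, the \emph{Flower snark} $J_r$ has the vertices $x_i,y_i,z_i,w_i$ and the edges $x_ix_{i+1},\,x_iy_i,\,y_iz_i,\,y_iw_i,\,z_iw_{i+1},\,w_iz_{i+1}$ for $0\le i<r$, with indices modulo $r$. Let $G$ be a snark and let $C$ be an even subgraph of $G$, i.e. every vertex has even degree in $C$ (so that the edges of $C$ form pairwise disjoint cycles). A \emph{superposition} of $G$ along $C$ by Flower snarks is a graph obtained as follows. (1) For every edge $e=uv$ of $C$ choose a Flower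 snark $J_r$ and two vertices $x,y$ of $J_r$ with $d(x,y)\ge 3$ (the choice may depend on $e$). Replace $e$ by the superedge $(J_r)_{x,y}$, obtained from $J_r$ by removing $x$ and $y$ and keeping the three edges at $x$ and the three edges at $y$ as semiedges. Assign the three semiedges from $x$ to the end $u$ of $e$, and the three semiedges from $y$ to the end $v$. (2) For every vertex $u$ that lies on two edges $e,e'$ of $C$, choose one of the supervertices $A$, $A'$, and number the three semiedges that $e$ assigns to $u$, and likewise the three that $e'$ assigns to $u$, by $0,1,2$ in an arbitrary way. (The numberings encode the semiedge permutations and the docks.) Join $u$ to the two semiedges with number $0$. If $A$ is chosen, then for each $k\in\{1,2\}$ merge the two semiedges with number $k$ into a single edge. If $A'$ is chosen, add two new vertices $u',u''$ and the edge $u'u''$, and join $u'$ to the two semiedges with number $1$ and $u''$ to the two semiedges with number $2$. (3) All other vertices of $G$, and all edges of $G$ that are not in $C$, are kept; in particular each vertex $u$ as in (2) keeps its third edge. \textbf{Theorem.} Let $G$ be a snark that has a normal $5$-edge-coloring, and let $C$ be an even subgraph of $G$. Then every superposition of $G$ along $C$ by Flower snarks has a normal $5$-edge-coloring, and hence a Petersen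 coloring. -/

import Mathlib

/-! Normal edge-colorings of cubic graphs, Flower snarks, and superpositions of a cubic graph along
an even subgraph. All graphs are simple. -/

namespace NormalColoring

/-- A graph is cubic if each vertex has exactly three neighbors. -/
def IsCubic {V : Type*} (G : SimpleGraph V) : Prop :=
  ∀ v : V, (G.neighborSet v).ncard = 3

/-- A graph is bridgeless if none of its edges is a bridge. -/
def IsBridgeless {V : Type*} (G : SimpleGraph V) : Prop :=
  ∀ e ∈ G.edgeSet, ¬ G.IsBridge e

/-- A snark (in the broad sense): a bridgeless cubic graph that has no proper 3-edge-coloring.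
A proper `k`-edge-coloring is a proper `k`-coloring of the line graph. -/
structure IsSnark {V : Type*} (G : SimpleGraph V) : Prop where
  cubic : IsCubic G
  bridgeless : IsBridgeless G
  not_three_edge_colorable : ¬ G.lineGraph.Colorable 3

/-- The set `∂(v)` of the edges incident to `v`. -/
def incidentEdges {V : Type*} (G : SimpleGraph V) (v : V) : Set G.edgeSet :=
  {e | v ∈ (e : Sym2 V)}

/-- The set `σ(v)` of the colors of the edges incident to `v`. -/
def colorsAt {V α : Type*} {G : SimpleGraph V} (σ : G.lineGraph.Coloring α) (v : V) : Set α :=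
  σ '' incidentEdges G v

/-- A proper edge-coloring is normal if each edge `uv` is poor (`|σ(u) ∪ σ(v)| = 3`) or
rich (`|σ(u) ∪ σ(v)| = 5`). -/
def IsNormal {V α : Type*} {G : SimpleGraph V} (σ : G.lineGraph.Coloring α) : Prop :=
  ∀ u v : V, G.Adj u v →
    (colorsAt σ u ∪ colorsAt σ v).ncard = 3 ∨ (colorsAt σ u ∪ colorsAt σ v).ncard = 5

/-- `G` has a normal 5-edge-coloring. -/
def HasNormalFiveEdgeColoring {V : Type*} (G : SimpleGraph V) : Prop :=
  ∃ σ : G.lineGraph.Coloring (Fin 5), IsNormal σ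

/-- An `H`-coloring of `G`: a map from the edges of `G` to the edges of `H` such that for every
vertex `v` of `G` there is a vertex `w` of `H` with `φ(∂(v)) = ∂(w)`. -/
def IsGraphColoring {V W : Type*} (G : SimpleGraph V) (H : SimpleGraph W)
    (φ : G.edgeSet → H.edgeSet) : Prop :=
  ∀ v : V, ∃ w : W, φ '' incidentEdges G v = incidentEdges H w

/-- The Petersen graph: its vertices are the 2-element subsets of a 5-element set, and two of them
are adjacent if they are disjoint. -/
def petersenGraph : SimpleGraph {s : Finset (Fin 5) // s.card = 2} where
  Adj s t := Disjoint s.1 t.1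
  symm := ⟨fun _ _ h => h.symm⟩
  loopless := ⟨fun s h => by
    have h1 : s.1 = ∅ := by simpa using h
    have h2 := s.2
    simp [h1] at h2⟩

/-- `G` has a Petersen coloring. -/
def HasPetersenColoring {V : Type*} (G : SimpleGraph V) : Prop :=
  ∃ φ : G.edgeSet → petersenGraph.edgeSet, IsGraphColoring G petersenGraph φ

/-- The four kinds of vertices of a Flower snark. -/
inductive Petal
  | x
  | y
  | z
  | w

/-- The edges `x_i x_{i+1}`, `x_i y_i`, `y_i z_i`, `y_i w_i`, `z_i w_{i+1}`, `w_i z_{i+1}`,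
with indices modulo `r`. -/
inductive FlowerRel (r : ℕ) : Petal × ZMod r → Petal × ZMod r → Prop
  | xx (i : ZMod r) : FlowerRel r (.x, i) (.x, i + 1)
  | xy (i : ZMod r) : FlowerRel r (.x, i) (.y, i)
  | yz (i : ZMod r) : FlowerRel r (.y, i) (.z, i)
  | yw (i : ZMod r) : FlowerRel r (.y, i) (.w, i)
  | zw (i : ZMod r) : FlowerRel r (.z, i) (.w, i + 1)
  | wz (i : ZMod r) : FlowerRel r (.w, i) (.z, i + 1)

/-- The graph `J_r`; it is called a Flower snark when `r ≥ 5` is odd. -/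
def flower (r : ℕ) : SimpleGraph (Petal × ZMod r) :=
  SimpleGraph.fromRel (FlowerRel r)

/-- `H` is (a copy of) a Flower snark. -/
def IsFlowerSnark {W : Type*} (H : SimpleGraph W) : Prop :=
  ∃ r : ℕ, Odd r ∧ 5 ≤ r ∧ Nonempty (H ≃g flower r)

/-- An even subgraph: every vertex has even degree in it. -/
def IsEvenSubgraph {V : Type*} {G : SimpleGraph V} (C : G.Subgraph) : Prop :=
  ∀ v : V, Even (C.neighborSet v).ncard

/-- The two supervertices. Both consist of a vertex `u` with one semiedge in each of the
three connectors, together with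
* for `A`: two isolated edges, each of them with one semiedge in each of the two 3-connectors;
* for `APrime`: two further vertices `u'` and `u''`, joined by an edge, each of them
  with one semiedge in each of the two 3-connectors. -/
inductive Supervertex
  | A
  | APrime

/-- The choices that determine a superposition of `G` along the subgraph `C`, where each edge `e`
of `C` is replaced by a superedge `H_{x,y}` and each vertex on `C` by `A` or `A'`.

The superedge of `e` is obtained from the graph `H e` by removing the two nonadjacent vertices
`pole e u` and `pole e v`, where `u` and `v` are the ends of `e`; the semiedges that arise from
the three edges at `pole e u` form the connector that is identified with a connector of the
supervertex of `u`, and similarly at `v`. These semiedges correspond to the neighbors of the pole.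

In either of its two 3-connectors, the supervertex of `u` has a semiedge `0` (incident to `u`),
and semiedges `1` and `2` (of the first and second isolated edge of `A`, or incident to `u'` and
`u''` in `A'`). The bijection `slot e u` tells which semiedge of the superedge is identified
with which semiedge of the supervertex. So the choice of the bijections `slot` is the choice
of all docks (the semiedges in slot `0`) and of all semiedge permutations. -/
structure SuperpositionData {V : Type*} {G : SimpleGraph V} (C : G.Subgraph) where
  /-- The vertices of the graph from which the superedge of `e` is obtained. -/
  W : C.edgeSet → Type*
  /-- The graph from which the superedge of `e` is obtained. -/
  H : ∀ e : C.edgeSet, SimpleGraph (W e)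
  /-- The vertex of `H e` that is removed to get the connector at the end `v` of `e`. -/
  pole : ∀ e : C.edgeSet, {v : V // v ∈ (e : Sym2 V)} → W e
  pole_ne : ∀ (e : C.edgeSet) (u v : {v : V // v ∈ (e : Sym2 V)}), u ≠ v → pole e u ≠ pole e v
  pole_not_adj : ∀ (e : C.edgeSet) (u v : {v : V // v ∈ (e : Sym2 V)}),
    ¬ (H e).Adj (pole e u) (pole e v)
  /-- The identification of the semiedges of the connector at the end `v` of `e` with the
  semiedges of a 3-connector of the supervertex of `v`. -/
  slot : ∀ (e : C.edgeSet) (v : {v : V // v ∈ (e : Sym2 V)}),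
    (H e).neighborSet (pole e v) ≃ Fin 3
  /-- The supervertex of each vertex on an edge of `C` (values at other vertices are not used). -/
  kind : V → Supervertex

namespace SuperpositionData

/-- The vertices of the superposition:
* the vertices of `G` (a vertex `u` on an edge of `C` being the vertex `u` of its supervertex);
* the vertices of the superedges, that is, the vertices of `H e` other than the two poles;
* the vertices `u'` (`k = 0`) and `u''` (`k = 1`) of the supervertices `A'`. -/
inductive Vertex {V : Type*} {G : SimpleGraph V} {C : G.Subgraph} (S : SuperpositionData C)
  | base (u : V) : Vertex S
  | inner (e : C.edgeSet) (a : S.W e) (ha : ∀ v, a ≠ S.pole e v) : Vertex S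
  | extra (u : V) (hu : u ∈ C.support) (hk : S.kind u = .APrime) (k : Fin 2) : Vertex S

/-- The edges of the superposition:
* `base`: the edges of `G` that are not in `C`;
* `inner`: the edges of the superedges;
* `dock`: the edges that join the vertex `u` of a supervertex to the superedges;
* `through`: the edges between two superedges that come from the isolated edges of a
  supervertex `A`;
* `spoke`: the edges that join `u'` and `u''` of a supervertex `A'` to the superedges;
* `rung`: the edge `u'u''` of a supervertex `A'`. -/
inductive Rel {V : Type*} {G : SimpleGraph V} {C : G.Subgraph} (S : SuperpositionData C) :
    Vertex S → Vertex S → Prop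
  | base (u v : V) (h : G.Adj u v) (hC : ¬ C.Adj u v) : Rel S (.base u) (.base v)
  | inner (e : C.edgeSet) (a b : S.W e) (ha : ∀ v, a ≠ S.pole e v) (hb : ∀ v, b ≠ S.pole e v)
      (h : (S.H e).Adj a b) : Rel S (.inner e a ha) (.inner e b hb)
  | dock (e : C.edgeSet) (u : V) (hu : u ∈ (e : Sym2 V)) (a : S.W e)
      (ha : ∀ v, a ≠ S.pole e v) (h : (S.H e).Adj (S.pole e ⟨u, hu⟩) a)
      (hs : S.slot e ⟨u, hu⟩ ⟨a, h⟩ = 0) : Rel S (.base u) (.inner e a ha)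
  | through (e f : C.edgeSet) (hef : e ≠ f) (u : V) (hue : u ∈ (e : Sym2 V))
      (huf : u ∈ (f : Sym2 V)) (hk : S.kind u = .A) (a : S.W e) (b : S.W f)
      (ha : ∀ v, a ≠ S.pole e v) (hb : ∀ v, b ≠ S.pole f v)
      (hadj : (S.H e).Adj (S.pole e ⟨u, hue⟩) a) (hbdj : (S.H f).Adj (S.pole f ⟨u, huf⟩) b)
      (k : Fin 2) (hsa : S.slot e ⟨u, hue⟩ ⟨a, hadj⟩ = k.succ)
      (hsb : S.slot f ⟨u, huf⟩ ⟨b, hbdj⟩ = k.succ) : Rel S (.inner e a ha) (.inner f b hb)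
  | spoke (e : C.edgeSet) (u : V) (hu : u ∈ (e : Sym2 V)) (huC : u ∈ C.support)
      (hk : S.kind u = .APrime) (a : S.W e) (ha : ∀ v, a ≠ S.pole e v)
      (h : (S.H e).Adj (S.pole e ⟨u, hu⟩) a) (k : Fin 2)
      (hs : S.slot e ⟨u, hu⟩ ⟨a, h⟩ = k.succ) : Rel S (.extra u huC hk k) (.inner e a ha)
  | rung (u : V) (hu : u ∈ C.support) (hk : S.kind u = .APrime) :
      Rel S (.extra u hu hk 0) (.extra u hu hk 1)

/-- The superposition of `G`. -/
def graph {V : Type*} {G : SimpleGraph V} {C : G.Subgraph} (S : SuperpositionData C) :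
    SimpleGraph (Vertex S) :=
  SimpleGraph.fromRel (Rel S)

end SuperpositionData

end NormalColoring

/-! Fix a normal coloring `σ` of `G`. The superposition is colored so that each of its vertices sees
a set `σ(v)` for some vertex `v` of `G`, and neighbors see the sets of equal or adjacent vertices of
`G`. Normality is then inherited from `σ`, and nothing has to be checked beyond properness and the
choice of these sets.

For `e = uv` in `C` with color `c`, the flower snark is colored so that every vertex other than the
poles sees `σ(u)` or `σ(v)`. Both contain `c`, so it suffices to color with the two model stars `{0,
1, 2}` and `{0, 3, 4}` and to substitute colors, `0` becoming `c`. The dock at each pole receives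
`c` and the other two semiedges receive one common color, which makes the permutation of the slots 1
and 2 irrelevant. The heart is `flower_dichotomy`: either the common colors at the two poles can be
`1` and `3`, or they can be `0` and `3` and also `1` and `0`. In the second case one end of `e`,
chosen at will, is degenerate: all three semiedges there have color `c`.

At a vertex `u` of `C` the two edges of `C` must agree on the common color for `A` and disagree for
`A'`. This is possible unless both are degenerate at `u` (`exists_connector_pair`). Orienting `C`
with distinct tails (`exists_tail`) and putting each degenerate end at the tail avoids that case.
The same condition makes the edges through `A` normal (`vertexColors_normal`).

The dichotomy is a finite computation. A coloring of a flower snark is a closed walk of an automaton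
whose states are the color triples on the cuts between consecutive columns. A step through an
ordinary column can be replaced by three such steps (`columnStep_none_mem`), so only short gaps
between the two poles need to be checked by evaluation. -/

namespace NormalColoring

/-! ### Edge colorings given by functions of two vertices -/

section Colorings

variable {V α : Type*} {G : SimpleGraph V}

theorem exists_lineGraph_coloring (F : V → V → α)
    (hs : ∀ u v, G.Adj u v → F u v = F v u)
    (hi : ∀ v, Set.InjOn (F v) (G.neighborSet v)) :
    ∃ σ : G.lineGraph.Coloring α, ∀ u v (h : G.Adj u v), σ ⟨s(u, v), h⟩ = F u v := by
  classical
  let col : G.edgeSet → α := fun e => F e.1.out.1 e.1.out.2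
  have hcol : ∀ u v (h : G.Adj u v), col ⟨s(u, v), h⟩ = F u v := by
    intro u v h
    have h1 : s((s(u, v)).out.1, (s(u, v)).out.2) = s(u, v) := Quot.out_eq _
    rcases Sym2.eq_iff.1 h1 with h2 | h2
    · simp only [col, h2.1, h2.2]
    · simp only [col, h2.1, h2.2]
      exact hs _ _ h.symm
  refine ⟨SimpleGraph.Coloring.mk col ?_, hcol⟩
  rintro ⟨e, he⟩ ⟨f, hf⟩ ⟨hne, v, hve, hvf⟩ heq
  obtain ⟨a, rfl⟩ := Sym2.mem_iff_exists.1 hve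
  obtain ⟨b, rfl⟩ := Sym2.mem_iff_exists.1 hvf
  rw [hcol v a he, hcol v b hf] at heq
  have hab := hi v he hf heq
  subst hab
  exact hne rfl

theorem colorsAt_eq_image (σ : G.lineGraph.Coloring α) (F : V → V → α)
    (h : ∀ u v (h : G.Adj u v), σ ⟨s(u, v), h⟩ = F u v) (v : V) :
    colorsAt σ v = F v '' G.neighborSet v := by
  ext c
  constructor
  · rintro ⟨⟨e, he⟩, hv, rfl⟩
    obtain ⟨a, rfl⟩ := Sym2.mem_iff_exists.1 hv
    exact ⟨a, he, (h v a he).symm⟩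
  · rintro ⟨a, ha, rfl⟩
    exact ⟨⟨s(v, a), ha⟩, Sym2.mem_mk_left v a, h v a ha⟩

theorem mem_colorsAt (σ : G.lineGraph.Coloring α) {e : G.edgeSet} {v : V} (h : v ∈ e.1) :
    σ e ∈ colorsAt σ v := ⟨e, h, rfl⟩

theorem lineGraph_coloring_injOn (σ : G.lineGraph.Coloring α) (v : V) :
    Set.InjOn σ (incidentEdges G v) := by
  intro e he f hf hef
  by_contra hne
  exact σ.valid (show G.lineGraph.Adj e f from ⟨hne, v, he, hf⟩) hef

theorem ncard_colorsAt (hG : IsCubic G) (σ : G.lineGraph.Coloring α) (v : V) :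
    (colorsAt σ v).ncard = 3 := by
  rw [colorsAt, (lineGraph_coloring_injOn σ v).ncard_image, ← hG v]
  symm
  refine Set.ncard_congr (fun a ha => ⟨s(v, a), ha⟩) (fun a ha => Sym2.mem_mk_left v a) ?_ ?_
  · intro a b ha hb hab
    exact Sym2.congr_right.1 (congrArg Subtype.val hab)
  · rintro ⟨e, he⟩ hv
    obtain ⟨a, rfl⟩ := Sym2.mem_iff_exists.1 hv
    exact ⟨a, he, rfl⟩

end Colorings

/-! ### From normal 5-edge-colorings to Petersen colorings -/

section Petersen

/-- Two triples that cover five colors share exactly one, so what `B` misses is `A` without the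
shared color. -/
theorem finset_compl_eq_erase : ∀ (A B : Finset (Fin 5)) (c : Fin 5), A.card = 3 → B.card = 3 →
    c ∈ A → c ∈ B → (A ∪ B).card = 5 → Bᶜ = A.erase c := by
  decide +kernel

theorem finset_eq_of_card_union {α : Type*} [DecidableEq α] {A B : Finset α} (hA : A.card = 3)
    (hB : B.card = 3) (h : (A ∪ B).card = 3) : A = B :=
  (Finset.eq_of_subset_of_card_le Finset.subset_union_left (by omega)).trans
    (Finset.eq_of_subset_of_card_le Finset.subset_union_right (by omega)).symm

variable {V : Type*} {G : SimpleGraph V}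

/-- An edge of color `c` at `v` is sent to the Petersen edge between the complement of `σ(v)` and
`σ(v) \ {c}`. Seen from the other end, a poor edge gives the same pair and a rich edge gives the
pair with its ends swapped, so the image depends on the edge only. -/
theorem hasPetersenColoring_of_isNormal (σ : G.lineGraph.Coloring (Fin 5)) (hσ : IsNormal σ)
    (h3 : ∀ v, (colorsAt σ v).ncard = 3) : HasPetersenColoring G := by
  classical
  let A : V → Finset (Fin 5) := fun v => (colorsAt σ v).toFinset
  have memA : ∀ v c, c ∈ A v ↔ c ∈ colorsAt σ v := fun v c => Set.mem_toFinset
  have cardA : ∀ v, (A v).card = 3 := fun v => by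
    rw [← h3 v, Set.ncard_eq_toFinset_card']
  have cardU : ∀ u v, (A u ∪ A v).card = (colorsAt σ u ∪ colorsAt σ v).ncard := fun u v => by
    rw [Set.ncard_eq_toFinset_card', Set.toFinset_union]
  let w : V → {s : Finset (Fin 5) // s.card = 2} := fun v =>
    ⟨(A v)ᶜ, by rw [Finset.card_compl, cardA]; rfl⟩
  let w' : ∀ (v : V) (c : Fin 5), c ∈ A v → {s : Finset (Fin 5) // s.card = 2} := fun v c h =>
    ⟨(A v).erase c, by rw [Finset.card_erase_of_mem h, cardA]⟩
  have hadj : ∀ v c (h : c ∈ A v), petersenGraph.Adj (w v) (w' v c h) := fun v c h => by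
    change Disjoint (A v)ᶜ ((A v).erase c)
    exact disjoint_compl_left.mono_right (Finset.erase_subset _ _)
  have mem_out : ∀ e : G.edgeSet, σ e ∈ A e.1.out.1 := fun e =>
    (memA _ _).2 (mem_colorsAt σ (Sym2.out_fst_mem e.1))
  let φ : G.edgeSet → petersenGraph.edgeSet := fun e =>
    ⟨s(w e.1.out.1, w' e.1.out.1 (σ e) (mem_out e)), hadj _ (σ e) (mem_out e)⟩
  have hw : ∀ (e : G.edgeSet) (u v : V) (hu : u ∈ e.1) (hv : v ∈ e.1) (hcu : σ e ∈ A u)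
      (hcv : σ e ∈ A v), s(w u, w' u (σ e) hcu) = s(w v, w' v (σ e) hcv) := by
    intro e u v hu hv hcu hcv
    rcases eq_or_ne u v with rfl | huv
    · rfl
    have huv' : G.Adj u v := by
      have := e.2
      rwa [((Sym2.mem_and_mem_iff huv).1 ⟨hu, hv⟩)] at this
    rcases hσ u v huv' with h | h
    · have hA : A u = A v := finset_eq_of_card_union (cardA u) (cardA v) (by rw [cardU, h])
      simp only [w, w', hA]
    · have h1 := finset_compl_eq_erase _ _ _ (cardA u) (cardA v) hcu hcv (by rw [cardU, h])
      have h2 := finset_compl_eq_erase _ _ _ (cardA v) (cardA u) hcv hcu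
        (by rw [Finset.union_comm, cardU, h])
      rw [Sym2.eq_swap]
      simp only [w, w', h1, h2]
  have hφ : ∀ (e : G.edgeSet) (v : V) (hv : v ∈ e.1),
      (φ e).1 = s(w v, w' v (σ e) ((memA _ _).2 (mem_colorsAt σ hv))) :=
    fun e v hv => hw e _ v (Sym2.out_fst_mem e.1) hv (mem_out e) ((memA _ _).2 (mem_colorsAt σ hv))
  refine ⟨φ, fun v => ⟨w v, Set.ext fun p => ⟨?_, ?_⟩⟩⟩
  · rintro ⟨e, he, rfl⟩
    change w v ∈ (φ e).1
    rw [hφ e v he]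
    exact Sym2.mem_mk_left _ _
  · obtain ⟨p, hp⟩ := p
    intro hv
    obtain ⟨t, rfl⟩ := Sym2.mem_iff_exists.1 hv
    -- A neighbor of the complement of `A v` is a 2-subset of `A v`; the omitted color identifies
    -- the edge at `v` that is mapped there.
    have hd : Disjoint (A v)ᶜ t.1 := hp
    have hsub : t.1 ⊆ A v := by
      rw [← disjoint_compl_left_iff]; exact hd
    obtain ⟨c, hc, hct⟩ : ∃ c ∈ A v, t.1 = (A v).erase c := by
      have : ((A v) \ t.1).card = 1 := by
        rw [Finset.card_sdiff_of_subset hsub, cardA, t.2]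
      obtain ⟨c, hc⟩ := Finset.card_eq_one.1 this
      have hc' : c ∈ A v \ t.1 := by rw [hc]; simp
      refine ⟨c, (Finset.mem_sdiff.1 hc').1, ?_⟩
      rw [← Finset.sdiff_singleton_eq_erase, ← hc, Finset.sdiff_sdiff_eq_self hsub]
    obtain ⟨e, he, rfl⟩ := (memA v c).1 hc
    refine ⟨e, he, Subtype.ext ?_⟩
    rw [hφ e v he]
    change s(w v, _) = s(w v, t)
    congr 2
    exact Subtype.ext hct.symm

/-- The form in which the final coloring is verified: symmetry on edges, a prescribed color set at
each vertex, and normality as a condition on these sets alone. -/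
theorem coloring_of_stars (F : V → V → Fin 5) (A : V → Set (Fin 5))
    (hs : ∀ u v, G.Adj u v → F u v = F v u)
    (hA : ∀ v, Set.BijOn (F v) (G.neighborSet v) (A v))
    (h3 : ∀ v, (A v).ncard = 3)
    (hn : ∀ u v, G.Adj u v → (A u ∪ A v).ncard = 3 ∨ (A u ∪ A v).ncard = 5) :
    HasNormalFiveEdgeColoring G ∧ HasPetersenColoring G := by
  obtain ⟨σ, hσ⟩ := exists_lineGraph_coloring F hs fun v => (hA v).injOn
  have hc : ∀ v, colorsAt σ v = A v := fun v => by
    rw [colorsAt_eq_image σ F hσ, (hA v).image_eq]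
  have hnorm : IsNormal σ := fun u v huv => by rw [hc, hc]; exact hn u v huv
  exact ⟨⟨σ, hnorm⟩, hasPetersenColoring_of_isNormal σ hnorm fun v => by rw [hc, h3]⟩

end Petersen

/-! ### The column automaton of flower snarks and its finite checks -/

section Automaton

/-- The colors of `x_i x_{i+1}`, `z_i w_{i+1}` and `w_i z_{i+1}`. -/
abbrev CutState := ℕ × ℕ × ℕ

/-- A column of a Flower snark is ordinary (`none`), or one of its vertices is a pole: then
`some (t, d, c)` records the kind `t` of the pole, the position `d` of its dock among its
neighbors, and the color `c` of its two other edges. -/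
abbrev ColumnKind := Option (Petal × Fin 3 × ℕ)

/-- The pairs that complete a color to a triple with set `{0, 1, 2}` or `{0, 3, 4}`. -/
def starCompletions : ℕ → List (ℕ × ℕ)
  | 0 => [(1, 2), (2, 1), (3, 4), (4, 3)]
  | 1 => [(0, 2), (2, 0)]
  | 2 => [(0, 1), (1, 0)]
  | 3 => [(0, 4), (4, 0)]
  | 4 => [(0, 3), (3, 0)]
  | _ => []

/-- The colors at a pole. -/
def poleTriple (d : Fin 3) (c : ℕ) : ℕ × ℕ × ℕ :=
  match d with
  | 0 => (0, c, c)
  | 1 => (c, 0, c)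
  | 2 => (c, c, 0)

def samePetal : Petal → Petal → Bool
  | .x, .x | .y, .y | .z, .z | .w, .w => true
  | _, _ => false

theorem samePetal_iff {s t : Petal} : samePetal s t = true ↔ s = t := by
  cases s <;> cases t <;> simp [samePetal]

/-- The pairs of colors that are admissible at the vertex of kind `t` in a column, in addition to
the color `c` of the first edge. -/
def completions (κ : ColumnKind) (t : Petal) (c : ℕ) : List (ℕ × ℕ) :=
  match κ with
  | none => starCompletions c
  | some (s, d, h) => bif samePetal s t then
      bif Nat.beq (poleTriple d h).1 c then [(poleTriple d h).2] else []
    else starCompletions c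

/-- The states of the cuts on the two sides of a column are compatible. -/
def ColumnStep (κ : ColumnKind) (s s' : CutState) : Prop :=
  ∃ xy yz yw : ℕ, (s'.1, xy) ∈ completions κ .x s.1 ∧ (yz, yw) ∈ completions κ .y xy ∧
    (s.2.2, s'.2.1) ∈ completions κ .z yz ∧ (s.2.1, s'.2.2) ∈ completions κ .w yw

/-- An executable enumeration of the successors of a state, with Boolean tests, so that the finite
checks can be settled by kernel evaluation. -/
def columnNext (κ : ColumnKind) (s : CutState) : List CutState :=
  (completions κ .x s.1).flatMap fun a => (completions κ .y a.2).flatMap fun b =>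
    (completions κ .z b.1).flatMap fun c => bif Nat.beq c.1 s.2.2 then
      (completions κ .w b.2).flatMap fun d => bif Nat.beq d.1 s.2.1 then
        [(a.1, c.2, d.2)] else [] else []

theorem mem_columnNext_iff {κ : ColumnKind} {s s' : CutState} :
    s' ∈ columnNext κ s ↔ ColumnStep κ s s' := by
  simp only [columnNext, List.mem_flatMap, Bool.cond_eq_ite, Nat.beq_eq,
    List.mem_ite_nil_right, List.mem_singleton]
  constructor
  · rintro ⟨⟨a1, a2⟩, ha, ⟨b1, b2⟩, hb, ⟨c1, c2⟩, hc, hc1, ⟨d1, d2⟩, hd, hd1, rfl⟩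
    dsimp only at *
    subst hc1 hd1
    exact ⟨_, _, _, ha, hb, hc, hd⟩
  · rintro ⟨xy, yz, yw, hx, hy, hz, hw⟩
    exact ⟨_, hx, _, hy, _, hz, rfl, _, hw, rfl, rfl⟩

def ColumnWalk : List ColumnKind → CutState → CutState → Prop
  | [], s, s' => s = s'
  | κ :: l, s, s' => ∃ m, ColumnStep κ s m ∧ ColumnWalk l m s'

def columnRun : List ColumnKind → CutState → List CutState
  | [], s => [s]
  | κ :: l, s => (columnNext κ s).flatMap (columnRun l)

theorem columnWalk_of_mem {l : List ColumnKind} {s s' : CutState} (h : s' ∈ columnRun l s) :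
    ColumnWalk l s s' := by
  induction l generalizing s with
  | nil => exact (List.mem_singleton.1 h).symm
  | cons κ l ih =>
    obtain ⟨m, hm, h⟩ := List.mem_flatMap.1 h
    exact ⟨m, mem_columnNext_iff.1 hm, ih h⟩

theorem columnWalk_append {l l' : List ColumnKind} {s s' : CutState} :
    ColumnWalk (l ++ l') s s' ↔ ∃ m, ColumnWalk l s m ∧ ColumnWalk l' m s' := by
  induction l generalizing s with
  | nil => simp [ColumnWalk]
  | cons κ l ih =>
    simp only [List.cons_append, ColumnWalk, ih]
    constructor
    · rintro ⟨m, h, n, h', h''⟩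
      exact ⟨n, ⟨m, h, h'⟩, h''⟩
    · rintro ⟨n, ⟨m, h, h'⟩, h''⟩
      exact ⟨m, h, n, h', h''⟩

def cutStates : List CutState :=
  [0, 1, 2, 3, 4].flatMap fun a => [0, 1, 2, 3, 4].flatMap fun b =>
    [0, 1, 2, 3, 4].map fun c => (a, b, c)

theorem mem_starCompletions {c : ℕ} {p : ℕ × ℕ} (h : p ∈ starCompletions c) :
    c ∈ [0, 1, 2, 3, 4] ∧ p.1 ∈ [0, 1, 2, 3, 4] := by
  unfold starCompletions at h
  split at h <;> simp_all <;> grind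

theorem ColumnStep.mem_cutStates {s s' : CutState} (h : ColumnStep none s s') :
    s ∈ cutStates := by
  obtain ⟨xy, yz, yw, hx, hy, hz, hw⟩ := h
  exact List.mem_flatMap.2 ⟨_, (mem_starCompletions hx).1, List.mem_flatMap.2
    ⟨_, (mem_starCompletions hw).2, List.mem_map.2 ⟨_, (mem_starCompletions hz).2, rfl⟩⟩⟩

/-- The pumping step: two further ordinary columns can be inserted without changing the states at
the two sides. It reduces all lengths of one parity to the shortest positive one. -/
theorem columnStep_none_mem : ∀ s ∈ cutStates, ∀ s' ∈ columnNext none s,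
    s' ∈ columnRun [none, none, none] s := by decide +kernel

theorem columnWalk_replicate_add_two {n : ℕ} (hn : 1 ≤ n) {s s' : CutState}
    (h : ColumnWalk (List.replicate n none) s s') :
    ColumnWalk (List.replicate (n + 2) none) s s' := by
  obtain ⟨n, rfl⟩ := Nat.exists_eq_add_of_le' hn
  -- Only the first ordinary column is expanded into three; this is why at least one must be
  -- present.
  obtain ⟨m, hm, h⟩ := h
  have h3 := columnWalk_of_mem (columnStep_none_mem s hm.mem_cutStates m (mem_columnNext_iff.2 hm))
  have : List.replicate (n + 1 + 2) (none : ColumnKind) =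
      [none, none, none] ++ List.replicate n none := by
    rw [show n + 1 + 2 = n + 1 + 1 + 1 by omega]; rfl
  rw [this]
  exact columnWalk_append.2 ⟨m, h3, h⟩

theorem columnWalk_replicate_mono {n m : ℕ} (hn : 1 ≤ n) (hnm : n ≤ m) (hp : n % 2 = m % 2)
    {s s' : CutState} (h : ColumnWalk (List.replicate n none) s s') :
    ColumnWalk (List.replicate m none) s s' := by
  obtain ⟨k, rfl⟩ : ∃ k, m = n + 2 * k := ⟨(m - n) / 2, by omega⟩
  clear hnm hp
  induction k with
  | zero => exact h
  | succ k ih => exact columnWalk_replicate_add_two (n := n + 2 * k) (by omega) ih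

/-- A pole, then `a` ordinary columns, another pole, and `b` ordinary columns. -/
def twoPoleWord (P Q : Petal × Fin 3 × ℕ) (a b : ℕ) : List ColumnKind :=
  some P :: (List.replicate a none ++ some Q :: List.replicate b none)

def HasClosedWalk (l : List ColumnKind) : Prop := ∃ s, ColumnWalk l s s

def closedWalkCheck (l : List ColumnKind) : Bool :=
  cutStates.any fun s => (columnRun l s).any fun s' =>
    Nat.beq s.1 s'.1 && Nat.beq s.2.1 s'.2.1 && Nat.beq s.2.2 s'.2.2

theorem hasClosedWalk_of_check {l : List ColumnKind} (h : closedWalkCheck l = true) :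
    HasClosedWalk l := by
  obtain ⟨s, -, h⟩ := List.any_eq_true.1 h
  obtain ⟨s', hs', h⟩ := List.any_eq_true.1 h
  have : s = s' := by
    simp only [Bool.and_eq_true, Nat.beq_eq] at h
    exact Prod.ext h.1.1 (Prod.ext h.1.2 h.2)
  subst this
  exact ⟨s, columnWalk_of_mem hs'⟩

theorem HasClosedWalk.mono {P Q : Petal × Fin 3 × ℕ} {a b a' b' : ℕ}
    (h : HasClosedWalk (twoPoleWord P Q a b))
    (ha : a = a' ∨ 1 ≤ a ∧ a ≤ a' ∧ a % 2 = a' % 2)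
    (hb : b = b' ∨ 1 ≤ b ∧ b ≤ b' ∧ b % 2 = b' % 2) :
    HasClosedWalk (twoPoleWord P Q a' b') := by
  obtain ⟨s, m, hm, h⟩ := h
  obtain ⟨m', h1, m'', h2, h3⟩ := columnWalk_append.1 h
  refine ⟨s, m, hm, columnWalk_append.2 ⟨m', ?_, m'', h2, ?_⟩⟩
  · rcases ha with rfl | ⟨ha, ha', ha''⟩
    · exact h1
    · exact columnWalk_replicate_mono ha ha' ha'' h1
  · rcases hb with rfl | ⟨hb, hb', hb''⟩
    · exact h3
    · exact columnWalk_replicate_mono hb hb' hb'' h3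

/-- Vertices of these kinds in consecutive columns are at distance at most 2. -/
def nearConsecutive : Petal → Petal → Bool
  | .x, .x | .x, .y | .y, .x | .z, .w | .w, .z | .z, .y | .w, .y | .y, .z | .y, .w => true
  | _, _ => false

/-- Vertices of these kinds in columns with exactly one column in between are at distance 2. -/
def nearSkipping : Petal → Petal → Bool
  | .x, .x | .z, .z | .w, .w => true
  | _, _ => false

/-- Either both poles can be given nonzero colors from different stars, or each of them can be
given the color zero. -/
def PoleDichotomy (t s : Petal) (d d' : Fin 3) (a b : ℕ) : Prop :=
  HasClosedWalk (twoPoleWord (t, d, 1) (s, d', 3) a b) ∨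
    HasClosedWalk (twoPoleWord (t, d, 0) (s, d', 3) a b) ∧
      HasClosedWalk (twoPoleWord (t, d, 1) (s, d', 0) a b)

def poleDichotomyCheck (a b : ℕ) (t s : Petal) : Bool :=
  [0, 1, 2].all fun d => [0, 1, 2].all fun d' =>
    closedWalkCheck (twoPoleWord (t, d, 1) (s, d', 3) a b) ||
      (closedWalkCheck (twoPoleWord (t, d, 0) (s, d', 3) a b) &&
        closedWalkCheck (twoPoleWord (t, d, 1) (s, d', 0) a b))

theorem poleDichotomy_of_check {a b : ℕ} {t s : Petal} (h : poleDichotomyCheck a b t s = true)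
    (d d' : Fin 3) : PoleDichotomy t s d d' a b := by
  have mem : ∀ d : Fin 3, d ∈ [0, 1, 2] := by decide
  have h := List.all_eq_true.1 (List.all_eq_true.1 h d (mem d)) d' (mem d')
  rw [Bool.or_eq_true, Bool.and_eq_true] at h
  exact h.imp hasClosedWalk_of_check fun h =>
    ⟨hasClosedWalk_of_check h.1, hasClosedWalk_of_check h.2⟩

theorem PoleDichotomy.mono {t s : Petal} {d d' : Fin 3} {a b a' b' : ℕ}
    (h : PoleDichotomy t s d d' a b)
    (ha : a = a' ∨ 1 ≤ a ∧ a ≤ a' ∧ a % 2 = a' % 2)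
    (hb : b = b' ∨ 1 ≤ b ∧ b ≤ b' ∧ b % 2 = b' % 2) : PoleDichotomy t s d d' a' b' :=
  h.imp (fun h => h.mono ha hb) fun h => ⟨h.1.mono ha hb, h.2.mono ha hb⟩

def petals : List Petal := [.x, .y, .z, .w]

theorem mem_petals (t : Petal) : t ∈ petals := by cases t <;> simp [petals]

/-- The gaps `(a, b)` in this and the next five checks are the shortest ones that can occur, up to
pumping: `a + b` is odd, a gap 0 cannot be pumped, and a gap 1 is excluded for kinds that would be
at distance 2. -/
theorem poleDichotomyCheck_zero_three : ∀ t ∈ petals, ∀ s ∈ petals,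
    nearConsecutive t s = false → poleDichotomyCheck 0 3 t s = true := by decide +kernel

theorem poleDichotomyCheck_three_zero : ∀ t ∈ petals, ∀ s ∈ petals,
    nearConsecutive t s = false → poleDichotomyCheck 3 0 t s = true := by decide +kernel

theorem poleDichotomyCheck_one_two : ∀ t ∈ petals, ∀ s ∈ petals,
    nearSkipping t s = false → poleDichotomyCheck 1 2 t s = true := by decide +kernel

theorem poleDichotomyCheck_two_one : ∀ t ∈ petals, ∀ s ∈ petals,
    nearSkipping t s = false → poleDichotomyCheck 2 1 t s = true := by decide +kernel

theorem poleDichotomyCheck_two_three : ∀ t ∈ petals, ∀ s ∈ petals,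
    nearSkipping t s = true → poleDichotomyCheck 2 3 t s = true := by decide +kernel

theorem poleDichotomyCheck_three_two : ∀ t ∈ petals, ∀ s ∈ petals,
    nearSkipping t s = true → poleDichotomyCheck 3 2 t s = true := by decide +kernel

theorem poleDichotomy {t s : Petal} (d d' : Fin 3) {a b : ℕ} (hab : Odd (a + b))
    (h3 : 3 ≤ a + b) (h1 : a = 0 ∨ b = 0 → nearConsecutive t s = false)
    (h2 : a = 1 ∨ b = 1 → nearSkipping t s = false) : PoleDichotomy t s d d' a b := by
  rw [Nat.odd_iff] at hab
  have ht := mem_petals t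
  have hs := mem_petals s
  rcases Nat.eq_zero_or_pos a with rfl | ha
  · exact (poleDichotomy_of_check (poleDichotomyCheck_zero_three t ht s hs (h1 (.inl rfl)))
      d d').mono (.inl rfl) (.inr (by omega))
  rcases Nat.eq_zero_or_pos b with rfl | hb
  · exact (poleDichotomy_of_check (poleDichotomyCheck_three_zero t ht s hs (h1 (.inr rfl)))
      d d').mono (.inr (by omega)) (.inl rfl)
  cases hn : nearSkipping t s
  · rcases Nat.mod_two_eq_zero_or_one a with ha2 | ha2
    · exact (poleDichotomy_of_check (poleDichotomyCheck_two_one t ht s hs hn)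
        d d').mono (.inr (by omega)) (.inr (by omega))
    · exact (poleDichotomy_of_check (poleDichotomyCheck_one_two t ht s hs hn)
        d d').mono (.inr (by omega)) (.inr (by omega))
  -- With gaps of length 1 excluded, the odd gap is at least 3 and the even one at least 2.
  · have hab1 : a ≠ 1 ∧ b ≠ 1 := by
      constructor <;> rintro rfl <;> simp_all
    rcases Nat.mod_two_eq_zero_or_one a with ha2 | ha2
    · exact (poleDichotomy_of_check (poleDichotomyCheck_two_three t ht s hs hn)
        d d').mono (.inr (by omega)) (.inr (by omega))
    · exact (poleDichotomy_of_check (poleDichotomyCheck_three_two t ht s hs hn)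
        d d').mono (.inr (by omega)) (.inr (by omega))

end Automaton

/-! ### Colorings of superedges -/

section Superedges

/-- The edges at the pole `x` are colored `c` at the neighbor `d` and `p` otherwise. -/
def IsPoleColoring {W α : Type*} (H : SimpleGraph W) (f : W → W → α) (x d : W) (c p : α) : Prop :=
  ∀ b, H.Adj x b → (b = d → f x b = c) ∧ (b ≠ d → f x b = p)

/-- An edge coloring of `H` in which each vertex other than the poles `x` and `y` sees three
different colors that form the set `A` or the set `B`, and each pole sees the color `c` on the edge
to its dock and the color `p` (respectively `q`) on its other edges. -/
def SuperedgeColorable {W α : Type*} (H : SimpleGraph W) (x y dx dy : W) (A B : Set α)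
    (c p q : α) : Prop :=
  ∃ f : W → W → α, (∀ a b, H.Adj a b → f a b = f b a) ∧
    (∀ a, a ≠ x → a ≠ y → Set.BijOn (f a) (H.neighborSet a) A ∨
      Set.BijOn (f a) (H.neighborSet a) B) ∧
    IsPoleColoring H f x dx c p ∧ IsPoleColoring H f y dy c q

/-- The substitution `g` has to be injective on each of the two stars only. It may identify colors
of different stars, as happens when the edge is poor. -/
theorem SuperedgeColorable.map {W α β : Type*} {H : SimpleGraph W} {x y dx dy : W} {A B : Set α}
    {c p q : α} (h : SuperedgeColorable H x y dx dy A B c p q) (g : α → β) {A' B' : Set β}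
    (hA : Set.BijOn g A A') (hB : Set.BijOn g B B') :
    SuperedgeColorable H x y dx dy A' B' (g c) (g p) (g q) := by
  obtain ⟨f, hs, hf, hx, hy⟩ := h
  refine ⟨fun a b => g (f a b), fun a b hab => congrArg g (hs a b hab), fun a hax hay =>
    (hf a hax hay).imp (hA.comp ·) (hB.comp ·), fun b hb => ⟨fun h => ?_, fun h => ?_⟩,
    fun b hb => ⟨fun h => ?_, fun h => ?_⟩⟩
  · exact congrArg g ((hx b hb).1 h)
  · exact congrArg g ((hx b hb).2 h)
  · exact congrArg g ((hy b hb).1 h)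
  · exact congrArg g ((hy b hb).2 h)

theorem SuperedgeColorable.of_iso {W W' α : Type*} {H : SimpleGraph W} {H' : SimpleGraph W'}
    (φ : H ≃g H') {x y dx dy : W} {A B : Set α} {c p q : α}
    (h : SuperedgeColorable H' (φ x) (φ y) (φ dx) (φ dy) A B c p q) :
    SuperedgeColorable H x y dx dy A B c p q := by
  obtain ⟨f, hs, hf, hx, hy⟩ := h
  have hbij : ∀ a, Set.BijOn φ (H.neighborSet a) (H'.neighborSet (φ a)) := fun a =>
    ⟨fun b hb => φ.map_adj_iff.2 hb, φ.injective.injOn, fun b hb =>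
      ⟨φ.symm b, by
        have : H'.Adj (φ a) (φ (φ.symm b)) := by rwa [φ.apply_symm_apply]
        exact φ.map_adj_iff.1 this, φ.apply_symm_apply b⟩⟩
  have hpole : ∀ {x d p}, IsPoleColoring H' f (φ x) (φ d) c p →
      IsPoleColoring H (fun a b => f (φ a) (φ b)) x d c p := fun h b hb =>
    ⟨fun e => (h _ (φ.map_adj_iff.2 hb)).1 (congrArg φ e),
      fun e => (h _ (φ.map_adj_iff.2 hb)).2 (φ.injective.ne e)⟩
  exact ⟨fun a b => f (φ a) (φ b), fun a b hab => hs _ _ (φ.map_adj_iff.2 hab),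
    fun a hax hay => (hf (φ a) (φ.injective.ne hax) (φ.injective.ne hay)).imp
      (·.comp (hbij a)) (·.comp (hbij a)), hpole hx, hpole hy⟩

end Superedges

/-! ### Flower snarks: from closed walks to colorings, and distances -/

section Flower

theorem ColumnWalk.exists_seq {l : List ColumnKind} {s s' : CutState} (h : ColumnWalk l s s') :
    ∃ q : ℕ → CutState, q 0 = s ∧ q l.length = s' ∧
      ∀ i κ, l[i]? = some κ → ColumnStep κ (q i) (q (i + 1)) := by
  induction l generalizing s with
  | nil => exact ⟨fun _ => s, rfl, h, by simp⟩
  | cons κ l ih =>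
    obtain ⟨m, hm, h⟩ := h
    obtain ⟨q, rfl, hq, hstep⟩ := ih h
    refine ⟨fun n => n.casesOn s q, rfl, hq, fun i κ' hi => ?_⟩
    cases i with
    | zero =>
      obtain rfl : κ = κ' := by simpa using hi
      exact hm
    | succ i => exact hstep i κ' (by simpa using hi)

theorem length_twoPoleWord (P Q : Petal × Fin 3 × ℕ) (a b : ℕ) :
    (twoPoleWord P Q a b).length = a + b + 2 := by
  simp [twoPoleWord]; omega

theorem twoPoleWord_getElem? (P Q : Petal × Fin 3 × ℕ) {a b i : ℕ} (hi : i < a + b + 2) :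
    (twoPoleWord P Q a b)[i]? =
      some (if i = 0 then some P else if i = a + 1 then some Q else none) := by
  unfold twoPoleWord
  rcases i with _ | i
  · simp
  rw [List.getElem?_cons_succ, List.getElem?_append]
  rcases lt_trichotomy i a with h | rfl | h
  · simp [h, h.ne]
  · simp
  · obtain ⟨k, rfl⟩ := Nat.exists_eq_add_of_lt h
    have h1 : a + k + 1 - a = k + 1 := by omega
    have h2 : k < b := by omega
    rw [List.length_replicate, if_neg (by omega), h1, List.getElem?_cons_succ, if_neg (by omega),
      if_neg (by omega)]
    simp [h2]

/-- The neighbors of a vertex of a Flower snark. -/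
def flowerNeighbor {r : ℕ} : Petal × ZMod r → Fin 3 → Petal × ZMod r
  | (.x, i) => ![(.x, i - 1), (.x, i + 1), (.y, i)]
  | (.y, i) => ![(.x, i), (.z, i), (.w, i)]
  | (.z, i) => ![(.y, i), (.w, i - 1), (.w, i + 1)]
  | (.w, i) => ![(.y, i), (.z, i - 1), (.z, i + 1)]

theorem FlowerRel.adj {r : ℕ} (hr : 5 ≤ r) {u v : Petal × ZMod r} (h : FlowerRel r u v) :
    (flower r).Adj u v := by
  have : Fact (1 < r) := ⟨by omega⟩
  refine ⟨?_, .inl h⟩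
  cases h <;> simp

theorem flower_adj_iff {r : ℕ} (hr : 5 ≤ r) {u v : Petal × ZMod r} :
    (flower r).Adj u v ↔ ∃ d, flowerNeighbor u d = v := by
  constructor
  · rintro ⟨-, h | h⟩ <;> cases h
    · exact ⟨1, rfl⟩
    · exact ⟨2, rfl⟩
    · exact ⟨1, rfl⟩
    · exact ⟨2, rfl⟩
    · exact ⟨2, rfl⟩
    · exact ⟨2, rfl⟩
    · exact ⟨0, by simp [flowerNeighbor]⟩
    · exact ⟨0, rfl⟩
    · exact ⟨0, rfl⟩
    · exact ⟨0, rfl⟩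
    · exact ⟨1, by simp [flowerNeighbor]⟩
    · exact ⟨1, by simp [flowerNeighbor]⟩
  · have hx : ∀ i : ZMod r, FlowerRel r (.x, i - 1) (.x, i) := fun i => by
      have h := FlowerRel.xx (i - 1)
      rwa [sub_add_cancel] at h
    have hz : ∀ i : ZMod r, FlowerRel r (.z, i - 1) (.w, i) := fun i => by
      have h := FlowerRel.zw (i - 1)
      rwa [sub_add_cancel] at h
    have hw : ∀ i : ZMod r, FlowerRel r (.w, i - 1) (.z, i) := fun i => by
      have h := FlowerRel.wz (i - 1)
      rwa [sub_add_cancel] at h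
    rintro ⟨d, rfl⟩
    obtain ⟨t, i⟩ := u
    cases t <;> fin_cases d
    · exact ((hx i).adj hr).symm
    · exact (FlowerRel.xx i).adj hr
    · exact (FlowerRel.xy i).adj hr
    · exact ((FlowerRel.xy i).adj hr).symm
    · exact (FlowerRel.yz i).adj hr
    · exact (FlowerRel.yw i).adj hr
    · exact ((FlowerRel.yz i).adj hr).symm
    · exact ((hw i).adj hr).symm
    · exact (FlowerRel.zw i).adj hr
    · exact ((FlowerRel.yw i).adj hr).symm
    · exact ((hz i).adj hr).symm
    · exact (FlowerRel.wz i).adj hr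

theorem zmod_sub_one_ne_add_one {r : ℕ} (hr : 5 ≤ r) (i : ZMod r) : i - 1 ≠ i + 1 := by
  intro h
  have h2 : ((2 : ℕ) : ZMod r) = 0 := by
    have : (i + 1) - (i - 1) = 0 := by rw [h, sub_self]
    push_cast
    rw [← this]; ring
  rw [ZMod.natCast_eq_zero_iff] at h2
  have := Nat.le_of_dvd (by norm_num) h2
  omega

theorem flowerNeighbor_injective {r : ℕ} (hr : 5 ≤ r) (u : Petal × ZMod r) :
    Function.Injective (flowerNeighbor u) := by
  obtain ⟨t, i⟩ := u
  have h := zmod_sub_one_ne_add_one hr i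
  intro d d' hd
  cases t <;> fin_cases d <;> fin_cases d' <;> simp [flowerNeighbor, h, h.symm] at hd ⊢

/-- Three different colors that form `{0, 1, 2}` or `{0, 3, 4}`. -/
def IsStarTriple (g : Fin 3 → ℕ) : Prop :=
  Function.Injective g ∧ (Set.range g = {0, 1, 2} ∨ Set.range g = {0, 3, 4})

theorem isStarTriple_of_mem {c : ℕ} {p : ℕ × ℕ} (h : p ∈ starCompletions c) :
    IsStarTriple ![c, p.1, p.2] := by
  have key : ∀ a b c, a ≠ b → a ≠ c → b ≠ c → Function.Injective ![a, b, (c : ℕ)] := by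
    intro a b c h1 h2 h3 i j hij
    fin_cases i <;> fin_cases j <;> simp_all
  have hr : ∀ a b c : ℕ, Set.range ![a, b, c] = {a, b, c} := by
    intro a b c
    refine Set.Subset.antisymm ?_ ?_
    · rintro _ ⟨i, rfl⟩
      fin_cases i <;> simp
    · rintro _ (rfl | rfl | rfl)
      exacts [⟨0, rfl⟩, ⟨1, rfl⟩, ⟨2, rfl⟩]
  unfold IsStarTriple
  rw [hr]
  unfold starCompletions at h
  split at h <;> simp only [List.mem_cons, List.not_mem_nil, or_false] at h
  all_goals (rcases h with rfl | rfl | rfl | rfl) <;>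
    refine ⟨key _ _ _ (by decide) (by decide) (by decide), ?_⟩ <;>
    first
    | (left; ext n; simp only [Set.mem_insert_iff, Set.mem_singleton_iff] <;> omega)
    | (right; ext n; simp only [Set.mem_insert_iff, Set.mem_singleton_iff] <;> omega)

theorem completions_pole {t : Petal} {d : Fin 3} {h c : ℕ} {p : ℕ × ℕ}
    (hp : p ∈ completions (some (t, d, h)) t c) (e : Fin 3) :
    ![c, p.1, p.2] e = if e = d then 0 else h := by
  have hs : samePetal t t = true := samePetal_iff.2 rfl
  simp only [completions, hs, Bool.cond_eq_ite, if_true, Nat.beq_eq, List.mem_ite_nil_right,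
    List.mem_singleton] at hp
  obtain ⟨rfl, rfl⟩ := hp
  fin_cases d <;> fin_cases e <;> rfl

theorem completions_of_ne {κ : ColumnKind} {t : Petal} {c : ℕ}
    (hκ : ∀ s d h, κ = some (s, d, h) → s ≠ t) : completions κ t c = starCompletions c := by
  rcases κ with _ | ⟨s, d, h⟩
  · rfl
  · have hs : samePetal s t = false := by
      rw [← Bool.not_eq_true, samePetal_iff]; exact hκ s d h rfl
    simp [completions, hs]

/-- Column `m` is read at position `(m - i).val` of the word, so the first pole lies in column `i`
and the second in column `j`. The states of the walk color the edges between columns, the witnesses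
of the steps color the edges inside them, and closedness lets the coloring wrap around. -/
theorem superedgeColorable_of_closedWalk {r : ℕ} (hr : 5 ≤ r) {a b : ℕ} (hab : a + b + 2 = r)
    {t s : Petal} {d d' : Fin 3} {h h' : ℕ}
    (hw : HasClosedWalk (twoPoleWord (t, d, h) (s, d', h') a b)) (i j : ZMod r)
    (hj : (j - i).val = a + 1) :
    SuperedgeColorable (flower r) (t, i) (s, j) (flowerNeighbor (t, i) d)
      (flowerNeighbor (s, j) d') {0, 1, 2} {0, 3, 4} 0 h h' := by
  have : NeZero r := ⟨by omega⟩
  have : Fact (1 < r) := ⟨by omega⟩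
  obtain ⟨s₀, hw⟩ := hw
  obtain ⟨q, hq0, hqr, hq⟩ := hw.exists_seq
  rw [length_twoPoleWord, hab] at hqr
  have hlt : ∀ m : ZMod r, (m - i).val < a + b + 2 := fun m => by rw [hab]; exact ZMod.val_lt _
  have hq' := fun m : ZMod r => hq _ _ (twoPoleWord_getElem? (t, d, h) (s, d', h') (hlt m))
  set κ : ZMod r → ColumnKind := fun m =>
    if (m - i).val = 0 then some (t, d, h) else if (m - i).val = a + 1 then some (s, d', h')
      else none with hκ
  choose xy yz yw hx hy hz hw' using hq'
  set st : ZMod r → CutState := fun m => q ((m - i).val + 1) with hst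
  -- The state before a column is the state after the previous one. At column `i` this is the
  -- wrap-around `q 0 = q r`.
  have hprev : ∀ m, q (m - i).val = st (m - 1) := by
    intro m
    simp only [hst]
    rcases eq_or_ne (m - i) 0 with h0 | h0
    · have : m - 1 - i = -1 := by rw [sub_right_comm, h0, zero_sub]
      rw [h0, this, ZMod.val_zero, hq0, ← hqr]
      congr 1
      have := ZMod.val_neg_of_ne_zero (1 : ZMod r)
      rw [this, ZMod.val_one]; omega
    · have : m - 1 - i = (m - i) - 1 := by ring
      rw [this, ZMod.val_sub (a := m - i) (b := 1), ZMod.val_one]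
      · have := ZMod.val_ne_zero (m - i) |>.2 h0
        congr 1; omega
      · rw [ZMod.val_one]; exact Nat.one_le_iff_ne_zero.2 ((ZMod.val_ne_zero _).2 h0)
  simp only [hprev] at hx hz hw'
  -- The colors are listed in the order of `flowerNeighbor`, which is also the order in which
  -- `completions` and `poleTriple` read them; the dock position `d` thus means the same in all of
  -- them.
  let tri : Petal × ZMod r → Fin 3 → ℕ := fun v => match v with
    | (.x, m) => ![(st (m - 1)).1, (st m).1, xy m]
    | (.y, m) => ![xy m, yz m, yw m]
    | (.z, m) => ![yz m, (st (m - 1)).2.2, (st m).2.1]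
    | (.w, m) => ![yw m, (st (m - 1)).2.1, (st m).2.2]
  have htri : ∀ u m, ∃ c p, p ∈ completions (κ m) u c ∧ tri (u, m) = ![c, p.1, p.2] := by
    intro u m
    cases u
    · exact ⟨_, _, hx m, rfl⟩
    · exact ⟨_, _, hy m, rfl⟩
    · exact ⟨_, _, hz m, rfl⟩
    · exact ⟨_, _, hw' m, rfl⟩
  classical
  -- The value 0 on nonadjacent pairs is arbitrary.
  let f : Petal × ZMod r → Petal × ZMod r → ℕ := fun v n =>
    if hn : ∃ e, flowerNeighbor v e = n then tri v hn.choose else 0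
  have hf : ∀ v e, f v (flowerNeighbor v e) = tri v e := by
    intro v e
    have hn : ∃ e', flowerNeighbor v e' = flowerNeighbor v e := ⟨e, rfl⟩
    simp only [f, dif_pos hn]
    exact congrArg _ (flowerNeighbor_injective hr v hn.choose_spec)
  have hrel : ∀ u v, FlowerRel r u v → f u v = f v u := by
    intro u v huv
    cases huv with
    | xx m =>
      have h1 := hf (.x, m) 1
      have h2 := hf (.x, m + 1) 0
      simp only [flowerNeighbor, tri, add_sub_cancel_right] at h1 h2
      exact h1.trans h2.symm
    | xy m => exact (hf (.x, m) 2).trans (hf (.y, m) 0).symm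
    | yz m => exact (hf (.y, m) 1).trans (hf (.z, m) 0).symm
    | yw m => exact (hf (.y, m) 2).trans (hf (.w, m) 0).symm
    | zw m =>
      have h1 := hf (.z, m) 2
      have h2 := hf (.w, m + 1) 1
      simp only [flowerNeighbor, tri, add_sub_cancel_right] at h1 h2
      exact h1.trans h2.symm
    | wz m =>
      have h1 := hf (.w, m) 2
      have h2 := hf (.z, m + 1) 1
      simp only [flowerNeighbor, tri, add_sub_cancel_right] at h1 h2
      exact h1.trans h2.symm
  have hpole : ∀ u m e k, κ m = some (u, e, k) →
      IsPoleColoring (flower r) f (u, m) (flowerNeighbor (u, m) e) 0 k := by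
    intro u m e k hk n hn
    obtain ⟨e', rfl⟩ := (flower_adj_iff hr).1 hn
    obtain ⟨c, p, hp, hc⟩ := htri u m
    rw [hk] at hp
    rw [hf, hc, completions_pole hp, (flowerNeighbor_injective hr _).eq_iff, ne_eq,
      (flowerNeighbor_injective hr _).eq_iff]
    exact ⟨fun h => if_pos h, fun h => if_neg h⟩
  refine ⟨f, ?_, ?_, ?_, ?_⟩
  · rintro u v ⟨-, huv | huv⟩
    · exact hrel u v huv
    · exact (hrel v u huv).symm
  · rintro ⟨u, m⟩ hut hus
    obtain ⟨c, p, hp, hc⟩ := htri u m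
    rw [completions_of_ne] at hp
    · obtain ⟨hinj, hrange⟩ := isStarTriple_of_mem hp
      rw [← hc] at hinj hrange
      have hbij : Set.BijOn (f (u, m)) ((flower r).neighborSet (u, m)) (Set.range (tri (u, m))) := by
        refine ⟨?_, ?_, ?_⟩
        · intro n hn
          obtain ⟨e, rfl⟩ := (flower_adj_iff hr).1 hn
          exact ⟨e, (hf _ _).symm⟩
        · intro n hn n' hn' hnn
          obtain ⟨e, rfl⟩ := (flower_adj_iff hr).1 hn
          obtain ⟨e', rfl⟩ := (flower_adj_iff hr).1 hn'
          rw [hf, hf] at hnn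
          rw [hinj hnn]
        · rintro _ ⟨e, rfl⟩
          exact ⟨_, (flower_adj_iff hr).2 ⟨e, rfl⟩, hf _ _⟩
      exact hrange.imp (fun h => by rw [h] at hbij; exact hbij)
        fun h => by rw [h] at hbij; exact hbij
    · intro s' e k hk hsu
      subst hsu
      simp only [hκ] at hk
      split_ifs at hk with h1 h2
      · rw [ZMod.val_eq_zero, sub_eq_zero] at h1
        simp only [Option.some.injEq, Prod.mk.injEq] at hk
        exact hut (Prod.ext hk.1.symm h1)
      · rw [← hj] at h2
        have := sub_left_injective (ZMod.val_injective r h2)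
        simp only [Option.some.injEq, Prod.mk.injEq] at hk
        exact hus (Prod.ext hk.1.symm this)
  · exact hpole t i d h (by simp [hκ])
  · exact hpole s j d' h' (by simp only [hκ]; rw [hj]; simp)

theorem dist_le_two_of_adj {W : Type*} {H : SimpleGraph W} {u v w : W} (h : H.Adj u v)
    (h' : H.Adj v w) : H.dist u w ≤ 2 :=
  SimpleGraph.dist_le (.cons h (.cons h' .nil))

theorem dist_le_two_of_adj' {W : Type*} {H : SimpleGraph W} {u v : W} (h : H.Adj u v) :
    H.dist u v ≤ 2 :=
  (SimpleGraph.dist_le (.cons h .nil)).trans (by simp)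

theorem flower_dist_le_two_of_same {r : ℕ} (hr : 5 ≤ r) (t s : Petal) (i : ZMod r) :
    (flower r).dist (t, i) (s, i) ≤ 2 := by
  have hx := (FlowerRel.xy i).adj hr
  have hz := (FlowerRel.yz i).adj hr
  have hw := (FlowerRel.yw i).adj hr
  cases t <;> cases s <;> first
    | (rw [SimpleGraph.dist_self]; omega)
    | exact dist_le_two_of_adj' (by assumption)
    | exact dist_le_two_of_adj' (SimpleGraph.Adj.symm (by assumption))
    | exact dist_le_two_of_adj hx hz
    | exact dist_le_two_of_adj hx hw
    | exact dist_le_two_of_adj hz.symm hw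
    | exact dist_le_two_of_adj hw.symm hz
    | exact dist_le_two_of_adj hz.symm hx.symm
    | exact dist_le_two_of_adj hw.symm hx.symm

theorem flower_dist_le_two_of_consecutive {r : ℕ} (hr : 5 ≤ r) {t s : Petal}
    (h : nearConsecutive t s = true) (i : ZMod r) : (flower r).dist (t, i) (s, i + 1) ≤ 2 := by
  have hx := fun i => (FlowerRel.xy i).adj hr
  have hz := fun i => (FlowerRel.yz i).adj hr
  have hw := fun i => (FlowerRel.yw i).adj hr
  have hxx := (FlowerRel.xx i).adj hr
  have hzw := (FlowerRel.zw i).adj hr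
  have hwz := (FlowerRel.wz i).adj hr
  cases t <;> cases s <;> first
    | exact absurd h (by decide)
    | exact dist_le_two_of_adj' (by assumption)
    | exact dist_le_two_of_adj hxx (hx _)
    | exact dist_le_two_of_adj (hx _).symm hxx
    | exact dist_le_two_of_adj (hz _) hzw
    | exact dist_le_two_of_adj (hw _) hwz
    | exact dist_le_two_of_adj hzw (hw _).symm
    | exact dist_le_two_of_adj hwz (hz _).symm

theorem flower_dist_le_two_of_skipping {r : ℕ} (hr : 5 ≤ r) {t s : Petal}
    (h : nearSkipping t s = true) (i : ZMod r) : (flower r).dist (t, i) (s, i + 1 + 1) ≤ 2 := by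
  have hxx := fun i => (FlowerRel.xx i).adj hr
  have hzw := fun i => (FlowerRel.zw i).adj hr
  have hwz := fun i => (FlowerRel.wz i).adj hr
  cases t <;> cases s <;> first
    | exact absurd h (by decide)
    | exact dist_le_two_of_adj (hxx _) (hxx _)
    | exact dist_le_two_of_adj (hzw _) (hwz _)
    | exact dist_le_two_of_adj (hwz _) (hzw _)

theorem nearConsecutive_comm (t s : Petal) : nearConsecutive t s = nearConsecutive s t := by
  cases t <;> cases s <;> rfl

theorem nearSkipping_comm (t s : Petal) : nearSkipping t s = nearSkipping s t := by
  cases t <;> cases s <;> rfl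

/-- Here `a` and `b` count the columns strictly between the poles on the two sides of the cycle of
columns. Since `a + b + 2 = r`, their sum is odd and at least 3, and distance at least 3 rules out
exactly the configurations that the finite checks leave out. -/
theorem flower_dichotomy {r : ℕ} (ho : Odd r) (hr : 5 ≤ r) {x y dx dy : Petal × ZMod r}
    (hdist : 3 ≤ (flower r).dist x y) (hx : (flower r).Adj x dx) (hy : (flower r).Adj y dy) :
    SuperedgeColorable (flower r) x y dx dy {0, 1, 2} {0, 3, 4} 0 1 3 ∨
      SuperedgeColorable (flower r) x y dx dy {0, 1, 2} {0, 3, 4} 0 0 3 ∧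
        SuperedgeColorable (flower r) x y dx dy {0, 1, 2} {0, 3, 4} 0 1 0 := by
  have : NeZero r := ⟨by omega⟩
  obtain ⟨d, rfl⟩ := (flower_adj_iff hr).1 hx
  obtain ⟨d', rfl⟩ := (flower_adj_iff hr).1 hy
  obtain ⟨t, i⟩ := x
  obtain ⟨s, j⟩ := y
  have hlt := ZMod.val_lt (j - i)
  have hj : j = i + ((j - i).val : ZMod r) := by rw [ZMod.natCast_zmod_val]; ring
  obtain ⟨a, ha⟩ : ∃ a, (j - i).val = a + 1 := by
    refine Nat.exists_eq_succ_of_ne_zero fun h => ?_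
    rw [h, Nat.cast_zero, add_zero] at hj
    subst hj
    have := flower_dist_le_two_of_same hr t s j
    omega
  obtain ⟨b, hb⟩ : ∃ b, a + b + 2 = r := ⟨r - (a + 2), by omega⟩
  rw [ha] at hj
  -- The same configuration read the other way round, so that the distance bounds also apply when
  -- `b` is 0 or 1.
  have hi : i = j + ((b + 1 : ℕ) : ZMod r) := by
    have : ((a + 1 : ℕ) : ZMod r) + ((b + 1 : ℕ) : ZMod r) = 0 := by
      rw [← Nat.cast_add, show a + 1 + (b + 1) = r by omega, ZMod.natCast_self]
    rw [hj, add_assoc, this, add_zero]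
  have key : PoleDichotomy t s d d' a b := by
    refine poleDichotomy d d' ?_ (by omega) ?_ ?_
    · rw [Nat.odd_iff] at ho ⊢; omega
    · intro h
      by_contra hn
      rw [Bool.not_eq_false] at hn
      rcases h with rfl | rfl
      · have := flower_dist_le_two_of_consecutive hr hn i
        rw [hj] at hdist; push_cast at hdist
        omega
      · rw [nearConsecutive_comm] at hn
        have := flower_dist_le_two_of_consecutive hr hn j
        rw [SimpleGraph.dist_comm, hi] at hdist; push_cast at hdist
        omega
    · intro h
      by_contra hn
      rw [Bool.not_eq_false] at hn
      rcases h with rfl | rfl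
      · have := flower_dist_le_two_of_skipping hr hn i
        rw [hj] at hdist; push_cast at hdist
        rw [add_assoc, one_add_one_eq_two] at this
        omega
      · rw [nearSkipping_comm] at hn
        have := flower_dist_le_two_of_skipping hr hn j
        rw [SimpleGraph.dist_comm, hi] at hdist; push_cast at hdist
        rw [add_assoc, one_add_one_eq_two] at this
        omega
  exact key.imp (fun h => superedgeColorable_of_closedWalk hr hb h i j ha) fun h =>
    ⟨superedgeColorable_of_closedWalk hr hb h.1 i j ha,
      superedgeColorable_of_closedWalk hr hb h.2 i j ha⟩

theorem IsFlowerSnark.dichotomy {W : Type*} {H : SimpleGraph W} (hH : IsFlowerSnark H)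
    {x y dx dy : W} (hdist : 3 ≤ H.dist x y) (hx : H.Adj x dx) (hy : H.Adj y dy) :
    SuperedgeColorable H x y dx dy {0, 1, 2} {0, 3, 4} 0 1 3 ∨
      SuperedgeColorable H x y dx dy {0, 1, 2} {0, 3, 4} 0 0 3 ∧
        SuperedgeColorable H x y dx dy {0, 1, 2} {0, 3, 4} 0 1 0 := by
  obtain ⟨r, ho, hr, ⟨φ⟩⟩ := hH
  have hd : 3 ≤ (flower r).dist (φ x) (φ y) := by
    refine hdist.trans ?_
    -- The distance of unreachable vertices is 0 by convention, so the bound 3 forces a path.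
    have hreach : H.Reachable x y := by
      by_contra h
      rw [SimpleGraph.dist_eq_zero_of_not_reachable h] at hdist
      omega
    have hreach' : (flower r).Reachable (φ x) (φ y) := hreach.map φ.toHom
    obtain ⟨p, hp⟩ := hreach'.exists_walk_length_eq_dist
    rw [← hp]
    have := SimpleGraph.dist_le ((p.map φ.symm.toHom).copy (φ.symm_apply_apply x)
      (φ.symm_apply_apply y))
    simpa using this
  exact (flower_dichotomy ho hr hd (φ.map_adj_iff.2 hx) (φ.map_adj_iff.2 hy)).imp (·.of_iso φ)
    fun h => ⟨h.1.of_iso φ, h.2.of_iso φ⟩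

end Flower

/-! ### Substituting the colors of `G` and choosing colors at connectors -/

section Palettes

theorem exists_third {A : Set (Fin 5)} (hA : A.ncard = 3) {a b : Fin 5} (ha : a ∈ A) (hb : b ∈ A)
    (hab : a ≠ b) : ∃ c, c ≠ a ∧ c ≠ b ∧ A = {a, b, c} := by
  obtain ⟨x, y, z, hxy, hxz, hyz, rfl⟩ := Set.ncard_eq_three.1 hA
  simp only [Set.mem_insert_iff, Set.mem_singleton_iff] at ha hb
  rcases ha with rfl | rfl | rfl <;> rcases hb with rfl | rfl | rfl <;>
    first
    | exact absurd rfl hab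
    | exact ⟨z, by grind, by grind, by ext; grind⟩
    | exact ⟨y, by grind, by grind, by ext; grind⟩
    | exact ⟨x, by grind, by grind, by ext; grind⟩

theorem exists_second {A : Set (Fin 5)} (hA : A.ncard = 3) (c : Fin 5) : ∃ a ∈ A, a ≠ c :=
  Set.exists_ne_of_one_lt_ncard (by omega) c

theorem bijOn_triple {α β : Type*} {g : α → β} {a b c : α} (hab : g a ≠ g b) (hac : g a ≠ g c)
    (hbc : g b ≠ g c) : Set.BijOn g {a, b, c} {g a, g b, g c} := by
  refine ⟨?_, ?_, ?_⟩
  · rintro _ (rfl | rfl | rfl) <;> simp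
  · rintro _ (rfl | rfl | rfl) _ (rfl | rfl | rfl) h <;> first | rfl | exact absurd h (by grind)
  · rintro _ (rfl | rfl | rfl)
    exacts [⟨a, by simp, rfl⟩, ⟨b, by simp, rfl⟩, ⟨c, by simp, rfl⟩]

theorem exists_recoloring {A B : Set (Fin 5)} (hA : A.ncard = 3) (hB : B.ncard = 3) {c p q : Fin 5}
    (hcA : c ∈ A) (hcB : c ∈ B) (hp : p ∈ A) (hq : q ∈ B) (hpc : p ≠ c) (hqc : q ≠ c) :
    ∃ g : ℕ → Fin 5, g 0 = c ∧ g 1 = p ∧ g 3 = q ∧ Set.BijOn g {0, 1, 2} A ∧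
      Set.BijOn g {0, 3, 4} B := by
  obtain ⟨p', h1, h2, rfl⟩ := exists_third hA hcA hp hpc.symm
  obtain ⟨q', h3, h4, rfl⟩ := exists_third hB hcB hq hqc.symm
  let g : ℕ → Fin 5
    | 0 => c
    | 1 => p
    | 2 => p'
    | 3 => q
    | _ => q'
  exact ⟨g, rfl, rfl, rfl, bijOn_triple (g := g) hpc.symm h1.symm h2.symm,
    bijOn_triple (g := g) hqc.symm h3.symm h4.symm⟩

/-- The model colors 1 and 3 stand for any non-dock color of their star, since the substitution is
free to choose which of the two remaining colors of `A` and of `B` they become. -/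
theorem superedgeColorable_cases {W : Type*} {H : SimpleGraph W} {x y dx dy : W}
    (h : SuperedgeColorable H x y dx dy {0, 1, 2} {0, 3, 4} 0 1 3 ∨
      SuperedgeColorable H x y dx dy {0, 1, 2} {0, 3, 4} 0 0 3 ∧
        SuperedgeColorable H x y dx dy {0, 1, 2} {0, 3, 4} 0 1 0)
    {A B : Set (Fin 5)} (hA : A.ncard = 3) (hB : B.ncard = 3) {c : Fin 5}
    (hcA : c ∈ A) (hcB : c ∈ B) :
    (∀ p ∈ A, p ≠ c → ∀ q ∈ B, q ≠ c → SuperedgeColorable H x y dx dy A B c p q) ∨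
      (∀ q ∈ B, q ≠ c → SuperedgeColorable H x y dx dy A B c c q) ∧
        ∀ p ∈ A, p ≠ c → SuperedgeColorable H x y dx dy A B c p c := by
  refine h.imp (fun h p hp hpc q hq hqc => ?_) fun h => ⟨fun q hq hqc => ?_, fun p hp hpc => ?_⟩
  · obtain ⟨g, rfl, rfl, rfl, hgA, hgB⟩ := exists_recoloring hA hB hcA hcB hp hq hpc hqc
    exact h.map g hgA hgB
  · obtain ⟨p, hp, hpc⟩ := exists_second hA c
    obtain ⟨g, rfl, rfl, rfl, hgA, hgB⟩ := exists_recoloring hA hB hcA hcB hp hq hpc hqc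
    exact h.1.map g hgA hgB
  · obtain ⟨q, hq, hqc⟩ := exists_second hB c
    obtain ⟨g, rfl, rfl, rfl, hgA, hgB⟩ := exists_recoloring hA hB hcA hcB hp hq hpc hqc
    exact h.2.map g hgA hgB

/-- `a` and `b` are the dock colors of the two edges of `C` at a vertex, and `P`, `Q` say that the
respective edge is degenerate there. With the third color of `A` at hand every case is solvable
except that both are degenerate, which would force the colors `a ≠ b` and so exclude the supervertex
`A`. -/
theorem exists_connector_pair {A : Set (Fin 5)} (hA : A.ncard = 3) {a b : Fin 5} (ha : a ∈ A)
    (hb : b ∈ A) (hab : a ≠ b) {P Q : Prop} (hPQ : ¬ (P ∧ Q)) (κ : Supervertex) :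
    ∃ x ∈ A, ∃ y ∈ A, (x = a ↔ P) ∧ (y = b ↔ Q) ∧ (κ = .A → x = y) ∧ (κ = .APrime → x ≠ y) := by
  obtain ⟨c, hca, hcb, rfl⟩ := exists_third hA ha hb hab
  have hc : c ∈ ({a, b, c} : Set (Fin 5)) := by simp
  by_cases hP : P <;> by_cases hQ : Q <;> cases κ
  · exact absurd ⟨hP, hQ⟩ hPQ
  · exact absurd ⟨hP, hQ⟩ hPQ
  · exact ⟨a, ha, a, ha, by simp [hP], by simp [hQ, hab], by simp, by simp⟩
  · exact ⟨a, ha, c, hc, by simp [hP], by simp [hQ, hcb], by simp, by simp [hca.symm]⟩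
  · exact ⟨b, hb, b, hb, by simp [hP, hab.symm], by simp [hQ], by simp, by simp⟩
  · exact ⟨c, hc, b, hb, by simp [hP, hca], by simp [hQ], by simp, by simp [hcb]⟩
  · exact ⟨c, hc, c, hc, by simp [hP, hca], by simp [hQ, hcb], by simp, by simp⟩
  · exact ⟨b, hb, a, ha, by simp [hP, hab.symm], by simp [hQ, hab], by simp, by simp [hab.symm]⟩

end Palettes

/-! ### Even subgraphs of cubic graphs -/

section EvenSubgraphs

variable {V : Type*} {G : SimpleGraph V} {C : G.Subgraph}

/-- A positive even degree that is at most 3 equals 2. -/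
theorem exists_mate (hG : IsCubic G) (hC : IsEvenSubgraph C) (e : C.edgeSet) {u : V}
    (hu : u ∈ e.1) : ∃ f : C.edgeSet, f ≠ e ∧ u ∈ f.1 ∧
      ∀ g : C.edgeSet, u ∈ g.1 → g = e ∨ g = f := by
  obtain ⟨e, he⟩ := e
  obtain ⟨v, rfl⟩ := Sym2.mem_iff_exists.1 hu
  have hsub : C.neighborSet u ⊆ G.neighborSet u := C.neighborSet_subset u
  have hfin : (G.neighborSet u).Finite := Set.finite_of_ncard_ne_zero (by rw [hG]; omega)
  have hle := Set.ncard_le_ncard hsub hfin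
  have hpos : 0 < (C.neighborSet u).ncard := (Set.ncard_pos (hfin.subset hsub)).2 ⟨v, he⟩
  have h2 : (C.neighborSet u).ncard = 2 := by
    rw [hG] at hle
    obtain ⟨k, hk⟩ := hC u
    omega
  obtain ⟨x, y, hxy, hN⟩ := Set.ncard_eq_two.1 h2
  obtain ⟨w, hwv, hw⟩ : ∃ w, w ≠ v ∧ C.neighborSet u = {v, w} := by
    have hv : v ∈ C.neighborSet u := he
    rw [hN] at hv
    rcases hv with rfl | rfl
    · exact ⟨y, hxy.symm, hN⟩
    · exact ⟨x, hxy, hN.trans (Set.pair_comm _ _)⟩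
  have hwC : C.Adj u w := by
    have : w ∈ C.neighborSet u := by rw [hw]; simp
    exact this
  refine ⟨⟨s(u, w), hwC⟩, fun h => hwv (Sym2.congr_right.1 (congrArg Subtype.val h)),
    Sym2.mem_mk_left u w, ?_⟩
  rintro ⟨g, hg⟩ hug
  obtain ⟨z, rfl⟩ := Sym2.mem_iff_exists.1 hug
  have hz : z ∈ C.neighborSet u := hg
  rw [hw] at hz
  rcases hz with rfl | rfl
  · exact .inl rfl
  · exact .inr rfl

/-- The edges of an even subgraph of a cubic graph can be oriented so that they have different
tails. -/
theorem exists_tail [Finite V] (hG : IsCubic G) (hC : IsEvenSubgraph C) :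
    ∃ tail : C.edgeSet → V, Function.Injective tail ∧ ∀ e, tail e ∈ e.1 := by
  classical
  have : Fintype V := Fintype.ofFinite V
  -- Hall's theorem for edges against their ends. Hall's condition follows by double counting: each
  -- edge has two ends, and each vertex lies on at most two edges of `C`.
  have h := (Finset.all_card_le_biUnion_card_iff_exists_injective
    (fun e : C.edgeSet => e.1.toFinset)).1 fun s => by
      have := Finset.card_mul_le_card_mul (s := s) (t := s.biUnion fun e => e.1.toFinset)
        (fun (e : C.edgeSet) v => v ∈ e.1) (m := 2) (n := 2) ?_ ?_
      · omega
      · intro e he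
        have hsub : e.1.toFinset ⊆ Finset.bipartiteAbove (fun (e : C.edgeSet) v => v ∈ e.1)
            (s.biUnion fun e => e.1.toFinset) e := fun v hv =>
          Finset.mem_filter.2 ⟨Finset.mem_biUnion.2 ⟨e, he, hv⟩, Sym2.mem_toFinset.1 hv⟩
        have hcard : e.1.toFinset.card = 2 :=
          Sym2.card_toFinset_of_not_isDiag _ (G.not_isDiag_of_mem_edgeSet
            (C.edgeSet_subset e.2))
        rw [← hcard]
        exact Finset.card_le_card hsub
      · intro v hv
        obtain ⟨e, he, hv⟩ := Finset.mem_biUnion.1 hv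
        obtain ⟨f, -, -, hf⟩ := exists_mate hG hC e (Sym2.mem_toFinset.1 hv)
        refine (Finset.card_le_card (t := {e, f}) fun g hg => ?_).trans Finset.card_le_two
        simpa using hf g (Finset.mem_filter.1 hg).2
  obtain ⟨tail, hinj, htail⟩ := h
  exact ⟨tail, hinj, fun e => Sym2.mem_toFinset.1 (htail e)⟩

/-- The colors of the semiedges `1` and `2` of the connectors of the supervertices. -/
theorem exists_connector_colors (hG : IsCubic G) (hC : IsEvenSubgraph C) {A : V → Set (Fin 5)}
    (hA : ∀ v, (A v).ncard = 3) {c : C.edgeSet → Fin 5} (hc : ∀ e : C.edgeSet, ∀ v ∈ e.1, c e ∈ A v)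
    (hcc : ∀ (e f : C.edgeSet) v, v ∈ e.1 → v ∈ f.1 → e ≠ f → c e ≠ c f)
    (Z : C.edgeSet → V → Prop) (hZ : ∀ e f v, e ≠ f → ¬ (Z e v ∧ Z f v)) (kind : V → Supervertex) :
    ∃ p : C.edgeSet → V → Fin 5, ∀ (e : C.edgeSet), ∀ u ∈ e.1, p e u ∈ A u ∧ (p e u = c e ↔ Z e u) ∧
      ∀ f : C.edgeSet, f ≠ e → u ∈ f.1 →
        (kind u = .A → p e u = p f u) ∧ (kind u = .APrime → p e u ≠ p f u) := by
  classical
  have key : ∀ u, ∃ p : C.edgeSet → Fin 5, ∀ (e : C.edgeSet), u ∈ e.1 → p e ∈ A u ∧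
      (p e = c e ↔ Z e u) ∧ ∀ f : C.edgeSet, f ≠ e → u ∈ f.1 →
        (kind u = .A → p e = p f) ∧ (kind u = .APrime → p e ≠ p f) := by
    intro u
    by_cases hu : ∃ e : C.edgeSet, u ∈ e.1
    · obtain ⟨e, he⟩ := hu
      obtain ⟨f, hfe, hf, hall⟩ := exists_mate hG hC e he
      obtain ⟨x, hx, y, hy, hxe, hyf, h1, h2⟩ := exists_connector_pair (hA u) (hc e u he)
        (hc f u hf) (hcc e f u he hf hfe.symm) (hZ e f u hfe.symm) (kind u)
      refine ⟨fun g => if g = e then x else y, fun g hg => ?_⟩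
      rcases hall g hg with rfl | rfl
      · refine ⟨by simpa using hx, by simpa using hxe, fun g' hg' hug' => ?_⟩
        simpa [hg'] using ⟨h1, h2⟩
      · refine ⟨by simpa [hfe] using hy, by simpa [hfe] using hyf, fun g' hg' hug' => ?_⟩
        obtain rfl := (hall g' hug').resolve_right hg'
        simpa [hfe] using ⟨fun h => (h1 h).symm, fun h => (h2 h).symm⟩
    · exact ⟨fun _ => 0, fun e he => absurd ⟨e, he⟩ hu⟩
  choose p hp using key
  exact ⟨fun e u => p u e, fun e u he => hp u e he⟩

/-- The color of the edge `u'u''` of a supervertex `A'`. -/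
theorem exists_rung_color (hG : IsCubic G) (hC : IsEvenSubgraph C) {A : V → Set (Fin 5)}
    (hA : ∀ v, (A v).ncard = 3) (p : C.edgeSet → V → Fin 5) :
    ∃ rung : V → Fin 5, ∀ (e : C.edgeSet), ∀ u ∈ e.1, rung u ∈ A u ∧ p e u ≠ rung u := by
  have key : ∀ u, ∃ r : Fin 5, ∀ e : C.edgeSet, u ∈ e.1 → r ∈ A u ∧ p e u ≠ r := by
    intro u
    by_cases hu : ∃ e : C.edgeSet, u ∈ e.1
    · obtain ⟨e, he⟩ := hu
      obtain ⟨f, hfe, hf, hall⟩ := exists_mate hG hC e he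
      obtain ⟨r, hr, hr'⟩ : ∃ r ∈ A u, r ∉ ({p e u, p f u} : Set (Fin 5)) := by
        by_contra! h
        have := Set.ncard_le_ncard (s := A u) (t := {p e u, p f u}) h
        have := Set.ncard_insert_le (p e u) {p f u}
        rw [Set.ncard_singleton] at this
        have := hA u
        omega
      simp only [Set.mem_insert_iff, Set.mem_singleton_iff, not_or] at hr'
      refine ⟨r, fun g hg => ⟨hr, ?_⟩⟩
      rcases hall g hg with rfl | rfl
      exacts [Ne.symm hr'.1, Ne.symm hr'.2]
    · exact ⟨0, fun e he => absurd ⟨e, he⟩ hu⟩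
  choose rung hr using key
  exact ⟨rung, fun e u he => hr u e he⟩

end EvenSubgraphs

/-- Transfers a bijective star coloring from a vertex of `G` or of a flower snark to the
corresponding vertex of the superposition, where `R` matches each old neighbor with the new one that
replaces it. -/
theorem bijOn_of_rel {α β γ : Type*} {F : α → γ} {N : Set α} {f : β → γ} {M : Set β} {A : Set γ}
    (R : β → α → Prop) (hf : Set.BijOn f M A) (h1 : ∀ n ∈ N, ∃ b ∈ M, R b n)
    (h2 : ∀ b ∈ M, ∃ n ∈ N, R b n) (h3 : ∀ b ∈ M, ∀ n, R b n → F n = f b)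
    (h4 : ∀ b n n', R b n → R b n' → n = n') : Set.BijOn F N A := by
  refine ⟨fun n hn => ?_, fun n hn n' hn' h => ?_, fun c hc => ?_⟩
  · obtain ⟨b, hb, hR⟩ := h1 n hn
    rw [h3 b hb n hR]
    exact hf.mapsTo hb
  · obtain ⟨b, hb, hR⟩ := h1 n hn
    obtain ⟨b', hb', hR'⟩ := h1 n' hn'
    rw [h3 b hb n hR, h3 b' hb' n' hR'] at h
    obtain rfl := hf.injOn hb hb' h
    exact h4 _ _ _ hR hR'
  · obtain ⟨b, hb, rfl⟩ := hf.surjOn hc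
    obtain ⟨n, hn, hR⟩ := h2 b hb
    exact ⟨n, hn, h3 b hb n hR⟩

theorem bijOn_neighborSet {V α : Type*} {G : SimpleGraph V} (σ : G.lineGraph.Coloring α)
    (F : V → V → α) (h : ∀ u v (h : G.Adj u v), σ ⟨s(u, v), h⟩ = F u v) (v : V) :
    Set.BijOn (F v) (G.neighborSet v) (colorsAt σ v) := by
  rw [colorsAt_eq_image σ F h]
  refine Set.InjOn.bijOn_image fun a ha b hb hab => ?_
  rw [← h v a ha, ← h v b hb] at hab
  have := lineGraph_coloring_injOn σ v (Sym2.mem_mk_left v a) (Sym2.mem_mk_left v b) hab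
  exact Sym2.congr_right.1 (congrArg Subtype.val this)

theorem eq_of_mem_edges {V : Type*} {e f : Sym2 V} (hef : e ≠ f) {u v : V} (hue : u ∈ e)
    (huf : u ∈ f) (hve : v ∈ e) (hvf : v ∈ f) : u = v := by
  by_contra huv
  exact hef (((Sym2.mem_and_mem_iff huv).1 ⟨hue, hve⟩).trans
    ((Sym2.mem_and_mem_iff huv).1 ⟨huf, hvf⟩).symm)

/-- A color other than that of the edge thus determines which of the two stars a vertex of the
superedge sees, unless the stars coincide. -/
theorem eq_or_inter_eq_of_ncard_union {A B : Set (Fin 5)} (hA : A.ncard = 3) (hB : B.ncard = 3)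
    (h : (A ∪ B).ncard = 3 ∨ (A ∪ B).ncard = 5) :
    A = B ∨ ∀ c ∈ A, c ∈ B → ∀ d ∈ A, d ∈ B → c = d := by
  rcases h with h | h
  · exact .inl ((Set.eq_of_subset_of_ncard_le Set.subset_union_left (by omega)).trans
      (Set.eq_of_subset_of_ncard_le Set.subset_union_right (by omega)).symm)
  · right
    intro c hcA hcB d hdA hdB
    have := Set.ncard_union_add_ncard_inter A B
    exact ((Set.ncard_le_one (Set.toFinite _)).1 (show (A ∩ B).ncard ≤ 1 by omega)) c ⟨hcA, hcB⟩ d ⟨hdA, hdB⟩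

/-! ### Neighborhoods in the superposition -/

namespace SuperpositionData

variable {V : Type*} {G : SimpleGraph V} {C : G.Subgraph} (S : SuperpositionData C)

/-- The superedge of `e` has a coloring in which the docks have color `c`, the other semiedges at the
end `v` have color `p v`, and each vertex sees the three colors of `A v` for an end `v` of `e`. -/
def SuperedgeFits (A : V → Set (Fin 5)) (e : C.edgeSet) (c : Fin 5) (p : V → Fin 5)
    (f : S.W e → S.W e → Fin 5) : Prop :=
  (∀ a b, (S.H e).Adj a b → f a b = f b a) ∧
    (∀ a, (∀ v, a ≠ S.pole e v) → ∃ v ∈ e.1, Set.BijOn (f a) ((S.H e).neighborSet a) (A v)) ∧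
    ∀ (v : {v : V // v ∈ e.1}) (b : S.W e) (h : (S.H e).Adj (S.pole e v) b),
      f (S.pole e v) b = if S.slot e v ⟨b, h⟩ = 0 then c else p v

/-- The neighbor of a pole that corresponds to the slot `k`. -/
def semi (e : C.edgeSet) (u : V) (hu : u ∈ e.1) (k : Fin 3) : S.W e :=
  ((S.slot e ⟨u, hu⟩).symm k).1

theorem pole_adj_semi (e : C.edgeSet) (u : V) (hu : u ∈ e.1) (k : Fin 3) :
    (S.H e).Adj (S.pole e ⟨u, hu⟩) (S.semi e u hu k) :=
  ((S.slot e ⟨u, hu⟩).symm k).2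

theorem slot_semi (e : C.edgeSet) (u : V) (hu : u ∈ e.1) (k : Fin 3) :
    S.slot e ⟨u, hu⟩ ⟨S.semi e u hu k, S.pole_adj_semi e u hu k⟩ = k :=
  (S.slot e ⟨u, hu⟩).apply_symm_apply k

theorem eq_semi_of_slot_eq {e : C.edgeSet} {u : V} {hu : u ∈ e.1} {k : Fin 3} {a : S.W e}
    {h : (S.H e).Adj (S.pole e ⟨u, hu⟩) a} (hs : S.slot e ⟨u, hu⟩ ⟨a, h⟩ = k) :
    a = S.semi e u hu k := by
  subst hs
  simp [semi]

theorem semi_ne_pole (e : C.edgeSet) (u : V) (hu : u ∈ e.1) (k : Fin 3) (v : {v : V // v ∈ e.1}) :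
    S.semi e u hu k ≠ S.pole e v := fun h =>
  S.pole_not_adj e ⟨u, hu⟩ v (h ▸ S.pole_adj_semi e u hu k)

theorem semi_injective {e : C.edgeSet} {u : V} {hu : u ∈ e.1} {j k : Fin 3}
    (h : S.semi e u hu j = S.semi e u hu k) : j = k :=
  (S.slot e ⟨u, hu⟩).symm.injective (Subtype.ext h)

/-- The vertex of the superposition that is incident with the semiedge in slot `k`. -/
def semiVertex (e : C.edgeSet) (u : V) (hu : u ∈ e.1) (k : Fin 3) : S.Vertex :=
  .inner e (S.semi e u hu k) (S.semi_ne_pole e u hu k)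

theorem mem_support {e : C.edgeSet} {u : V} (hu : u ∈ e.1) : u ∈ C.support := by
  obtain ⟨e, he⟩ := e
  obtain ⟨v, rfl⟩ := Sym2.mem_iff_exists.1 hu
  exact ⟨v, he⟩

theorem exists_edge_of_mem_support {u : V} (hu : u ∈ C.support) : ∃ e : C.edgeSet, u ∈ e.1 := by
  obtain ⟨v, hv⟩ := hu
  exact ⟨⟨s(u, v), hv⟩, Sym2.mem_mk_left u v⟩

variable {S}

theorem Rel.ne {m n : S.Vertex} (h : Rel S m n) : m ≠ n := by
  cases h with
  | base u v h hC => rintro ⟨⟩; exact h.ne rfl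
  | inner e a b ha hb h => rintro ⟨⟩; exact h.ne rfl
  | dock => nofun
  | through e f hef => intro h; cases h; exact hef rfl
  | spoke => nofun
  | rung => nofun

theorem Rel.adj {m n : S.Vertex} (h : Rel S m n) : S.graph.Adj m n := ⟨h.ne, .inl h⟩

variable (S)

theorem rel_dock (e : C.edgeSet) (u : V) (hu : u ∈ e.1) :
    Rel S (.base u) (S.semiVertex e u hu 0) :=
  .dock e u hu _ _ (S.pole_adj_semi e u hu 0) (S.slot_semi e u hu 0)

theorem rel_through (e f : C.edgeSet) (hef : e ≠ f) (u : V) (hue : u ∈ e.1) (huf : u ∈ f.1)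
    (hk : S.kind u = .A) (k : Fin 2) :
    Rel S (S.semiVertex e u hue k.succ) (S.semiVertex f u huf k.succ) :=
  .through e f hef u hue huf hk _ _ _ _ (S.pole_adj_semi ..) (S.pole_adj_semi ..) k
    (S.slot_semi ..) (S.slot_semi ..)

theorem rel_spoke (e : C.edgeSet) (u : V) (hu : u ∈ e.1) (huC : u ∈ C.support)
    (hk : S.kind u = .APrime) (k : Fin 2) :
    Rel S (.extra u huC hk k) (S.semiVertex e u hu k.succ) :=
  .spoke e u hu huC hk _ _ (S.pole_adj_semi ..) k (S.slot_semi ..)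

/-- The vertex `n` is joined to the superedge of `e` by the semiedge in slot `k` at the
end `u` of `e`. -/
def Attached (e : C.edgeSet) (u : V) (k : Fin 3) (n : S.Vertex) : Prop :=
  (k = 0 ∧ n = .base u) ∨
    (S.kind u = .A ∧ ∃ (j : Fin 2) (f : C.edgeSet) (hf : u ∈ f.1), k = j.succ ∧ f ≠ e ∧
      n = S.semiVertex f u hf k) ∨
    ∃ (hk : S.kind u = .APrime) (huC : u ∈ C.support) (j : Fin 2), k = j.succ ∧ n = .extra u huC hk j

variable {S}

theorem Attached.adj {e : C.edgeSet} {u : V} {hu : u ∈ e.1} {k : Fin 3} {n : S.Vertex}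
    (h : S.Attached e u k n) : S.graph.Adj (S.semiVertex e u hu k) n := by
  rcases h with ⟨rfl, rfl⟩ | ⟨hk, j, f, hf, rfl, hfe, rfl⟩ | ⟨hk, huC, j, rfl, rfl⟩
  · exact (S.rel_dock e u hu).adj.symm
  · exact (S.rel_through e f hfe.symm u hu hf hk j).adj
  · exact (S.rel_spoke e u hu huC hk j).adj.symm

theorem exists_attached (hG : IsCubic G) (hC : IsEvenSubgraph C) {e : C.edgeSet} {u : V}
    (hu : u ∈ e.1) (k : Fin 3) : ∃ n, S.Attached e u k n := by
  rcases Fin.eq_zero_or_eq_succ k with rfl | ⟨j, rfl⟩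
  · exact ⟨_, .inl ⟨rfl, rfl⟩⟩
  cases hk : S.kind u with
  | A =>
    obtain ⟨f, hfe, hf, -⟩ := exists_mate hG hC e hu
    exact ⟨_, .inr (.inl ⟨hk, j, f, hf, rfl, hfe, rfl⟩)⟩
  | APrime => exact ⟨_, .inr (.inr ⟨hk, mem_support hu, j, rfl, rfl⟩)⟩

theorem Attached.unique (hG : IsCubic G) (hC : IsEvenSubgraph C) {e : C.edgeSet} {u : V}
    (hu : u ∈ e.1) {k : Fin 3} {n n' : S.Vertex} (h : S.Attached e u k n)
    (h' : S.Attached e u k n') : n = n' := by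
  rcases h with ⟨rfl, rfl⟩ | ⟨hk, j, f, hf, rfl, hfe, rfl⟩ | ⟨hk, huC, j, rfl, rfl⟩
  · rcases h' with ⟨-, rfl⟩ | ⟨hk', j', f', hf', h, hfe', rfl⟩ | ⟨hk', huC', j', h, rfl⟩
    · rfl
    · exact absurd h.symm (Fin.succ_ne_zero _)
    · exact absurd h.symm (Fin.succ_ne_zero _)
  · rcases h' with ⟨h, rfl⟩ | ⟨hk', j', f', hf', h, hfe', rfl⟩ | ⟨hk', huC', j', h, rfl⟩
    · exact absurd h (Fin.succ_ne_zero _)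
    · obtain ⟨g, -, -, hall⟩ := exists_mate hG hC e hu
      obtain rfl := (hall f hf).resolve_left hfe
      obtain rfl := (hall f' hf').resolve_left hfe'
      rfl
    · rw [hk] at hk'; cases hk'
  · rcases h' with ⟨h, rfl⟩ | ⟨hk', j', f', hf', h, hfe', rfl⟩ | ⟨hk', huC', j', h, rfl⟩
    · exact absurd h (Fin.succ_ne_zero _)
    · rw [hk] at hk'; cases hk'
    · rw [Fin.succ_inj.1 h]

theorem adj_inner {e : C.edgeSet} {a : S.W e} {ha : ∀ v, a ≠ S.pole e v} {n : S.Vertex}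
    (h : S.graph.Adj (.inner e a ha) n) :
    (∃ b hb, (S.H e).Adj a b ∧ n = .inner e b hb) ∨
      ∃ u hu k, a = S.semi e u hu k ∧ S.Attached e u k n := by
  obtain ⟨-, h | h⟩ := h
  · cases h with
    | inner _ _ b _ hb h => exact .inl ⟨b, hb, h, rfl⟩
    | through _ f hef u hue huf hk _ b _ hb hadj hbdj k hsa hsb =>
      refine .inr ⟨u, hue, k.succ, S.eq_semi_of_slot_eq hsa,
        .inr (.inl ⟨hk, k, f, huf, rfl, hef.symm, ?_⟩)⟩
      obtain rfl := S.eq_semi_of_slot_eq hsb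
      rfl
  · cases h with
    | inner _ b _ hb _ h => exact .inl ⟨b, hb, h.symm, rfl⟩
    | dock _ u hu _ _ h hs => exact .inr ⟨u, hu, 0, S.eq_semi_of_slot_eq hs, .inl ⟨rfl, rfl⟩⟩
    | through f _ hef u hue huf hk b _ hb _ hadj hbdj k hsa hsb =>
      refine .inr ⟨u, huf, k.succ, S.eq_semi_of_slot_eq hsb,
        .inr (.inl ⟨hk, k, f, hue, rfl, hef, ?_⟩)⟩
      obtain rfl := S.eq_semi_of_slot_eq hsa
      rfl
    | spoke _ u hu huC hk _ _ h k hs =>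
      exact .inr ⟨u, hu, k.succ, S.eq_semi_of_slot_eq hs, .inr (.inr ⟨hk, huC, k, rfl, rfl⟩)⟩

theorem adj_base {u : V} {n : S.Vertex} (h : S.graph.Adj (.base u) n) :
    (∃ v, G.Adj u v ∧ ¬ C.Adj u v ∧ n = .base v) ∨
      ∃ (e : C.edgeSet) (hu : u ∈ e.1), n = S.semiVertex e u hu 0 := by
  obtain ⟨-, h | h⟩ := h
  · cases h with
    | base _ v h hC => exact .inl ⟨v, h, hC, rfl⟩
    | dock e _ hu a ha h hs =>
      obtain rfl := S.eq_semi_of_slot_eq hs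
      exact .inr ⟨e, hu, rfl⟩
  · cases h with
    | base v _ h hC => exact .inl ⟨v, h.symm, fun h' => hC h'.symm, rfl⟩

theorem adj_extra {u : V} {hu : u ∈ C.support} {hk : S.kind u = .APrime} {k : Fin 2} {n : S.Vertex}
    (h : S.graph.Adj (.extra u hu hk k) n) :
    (∃ (e : C.edgeSet) (hu : u ∈ e.1), n = S.semiVertex e u hu k.succ) ∨
      ∃ j, j ≠ k ∧ n = .extra u hu hk j := by
  obtain ⟨-, h | h⟩ := h
  · cases h with
    | spoke e _ hue _ _ a ha h _ hs =>
      obtain rfl := S.eq_semi_of_slot_eq hs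
      exact .inl ⟨e, hue, rfl⟩
    | rung => exact .inr ⟨1, by decide, rfl⟩
  · cases h with
    | rung => exact .inr ⟨0, by decide, rfl⟩

theorem extra_adj_extra {u : V} {hu : u ∈ C.support} {hk : S.kind u = .APrime} {j k : Fin 2}
    (h : j ≠ k) : S.graph.Adj (.extra u hu hk k) (.extra u hu hk j) := by
  have h01 : S.graph.Adj (.extra u hu hk 0) (.extra u hu hk 1) := (Rel.rung u hu hk).adj
  fin_cases j <;> fin_cases k
  exacts [absurd rfl h, h01.symm, h01, absurd rfl h]

/-! ### The coloring of the superposition and its stars -/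

section EdgeColor

open Classical in
/-- The color of the edge between two vertices of the superposition. -/
noncomputable def edgeColor (F : V → V → Fin 5) (c : C.edgeSet → Fin 5)
    (p : C.edgeSet → V → Fin 5) (rung : V → Fin 5) (f : ∀ e, S.W e → S.W e → Fin 5) :
    S.Vertex → S.Vertex → Fin 5
  | .base u, .base v => F u v
  | .base _, .inner e _ _ => c e
  | .inner e _ _, .base _ => c e
  | .inner e a _, .inner e' b _ =>
    if h : e' = e then f e a (h ▸ b)
    else if h : ∃ u, u ∈ e.1 ∧ u ∈ e'.1 then p e h.choose else 0
  | .inner e _ _, .extra u _ _ _ => p e u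
  | .extra u _ _ _, .inner e _ _ => p e u
  | .extra u _ _ _, .extra _ _ _ _ => rung u
  | .base _, .extra _ _ _ _ => 0
  | .extra _ _ _ _, .base _ => 0

variable {F : V → V → Fin 5} {c : C.edgeSet → Fin 5}
    {p : C.edgeSet → V → Fin 5} {rung : V → Fin 5} {f : ∀ e, S.W e → S.W e → Fin 5}

theorem edgeColor_inner_same {e : C.edgeSet} {a b : S.W e} {ha : ∀ v, a ≠ S.pole e v}
    {hb : ∀ v, b ≠ S.pole e v} :
    edgeColor F c p rung f (.inner e a ha) (.inner e b hb) = f e a b := by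
  simp [edgeColor]

theorem edgeColor_inner_ne {e e' : C.edgeSet} (hne : e' ≠ e) {u : V} (hu : u ∈ e.1) (hu' : u ∈ e'.1)
    {a : S.W e} {b : S.W e'} {ha : ∀ v, a ≠ S.pole e v} {hb : ∀ v, b ≠ S.pole e' v} :
    edgeColor F c p rung f (.inner e a ha) (.inner e' b hb) = p e u := by
  have h : ∃ u, u ∈ e.1 ∧ u ∈ e'.1 := ⟨u, hu, hu'⟩
  simp only [edgeColor, dif_neg hne, dif_pos h]
  congr 1
  -- Two different edges share at most one vertex, so the chosen common end is `u`.
  exact eq_of_mem_edges (fun h => hne (Subtype.ext h).symm) h.choose_spec.1 h.choose_spec.2 hu hu'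

theorem Attached.edgeColor_eq {e : C.edgeSet} {u : V} (hu : u ∈ e.1) {k : Fin 3} {n : S.Vertex}
    (h : S.Attached e u k n) {a : S.W e} {ha : ∀ v, a ≠ S.pole e v} :
    edgeColor F c p rung f (.inner e a ha) n = if k = 0 then c e else p e u := by
  rcases h with ⟨rfl, rfl⟩ | ⟨hk, j, e', hf, rfl, hfe, rfl⟩ | ⟨hk, huC, j, rfl, rfl⟩
  · rfl
  · rw [if_neg (Fin.succ_ne_zero _)]
    exact edgeColor_inner_ne hfe hu hf
  · rw [if_neg (Fin.succ_ne_zero _)]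
    rfl

/-- The colors that are seen by a vertex of the superposition. -/
def vertexColors (A : V → Set (Fin 5)) (f : ∀ e, S.W e → S.W e → Fin 5) :
    S.Vertex → Set (Fin 5)
  | .base u => A u
  | .inner e a _ => f e a '' (S.H e).neighborSet a
  | .extra u _ _ _ => A u

variable {A : V → Set (Fin 5)}

theorem edgeColor_symm (hF : ∀ u v, G.Adj u v → F u v = F v u)
    (hp : ∀ (e e' : C.edgeSet) u, u ∈ e.1 → u ∈ e'.1 → e' ≠ e → S.kind u = .A → p e u = p e' u)
    (hf : ∀ e, S.SuperedgeFits A e (c e) (p e) (f e)) (m n : S.Vertex) (h : S.graph.Adj m n) :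
    edgeColor F c p rung f m n = edgeColor F c p rung f n m := by
  have key : ∀ m n, Rel S m n →
      edgeColor F c p rung f m n = edgeColor F c p rung f n m := by
    intro m n h
    cases h with
    | base u v h hC => exact hF u v h
    | inner e a b ha hb h =>
      rw [edgeColor_inner_same, edgeColor_inner_same]
      exact (hf e).1 a b h
    | dock => rfl
    | through e e' hee u hue hue' hk =>
      rw [edgeColor_inner_ne hee.symm hue hue', edgeColor_inner_ne hee hue' hue]
      exact hp e e' u hue hue' hee.symm hk
    | spoke => rfl
    | rung => rfl
  obtain ⟨-, h | h⟩ := h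
  · exact key m n h
  · exact (key n m h).symm

theorem bijOn_edgeColor_base (hF : ∀ v, Set.BijOn (F v) (G.neighborSet v) (A v))
    (hc : ∀ u v (h : C.Adj u v), c ⟨s(u, v), h⟩ = F u v) (u : V) :
    Set.BijOn (edgeColor F c p rung f (.base u)) (S.graph.neighborSet (.base u)) (A u) := by
  refine bijOn_of_rel (fun v n => (¬ C.Adj u v ∧ n = .base v) ∨
    ∃ (e : C.edgeSet) (hu : u ∈ e.1), e.1 = s(u, v) ∧ n = S.semiVertex e u hu 0) (hF u) ?_ ?_ ?_ ?_
  · intro n hn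
    rcases adj_base hn with ⟨v, h, hC, rfl⟩ | ⟨⟨e, he⟩, hu, rfl⟩
    · exact ⟨v, h, .inl ⟨hC, rfl⟩⟩
    · obtain ⟨v, rfl⟩ := Sym2.mem_iff_exists.1 hu
      exact ⟨v, C.adj_sub he, .inr ⟨_, hu, rfl, rfl⟩⟩
  · intro v hv
    by_cases h : C.Adj u v
    · exact ⟨_, (S.rel_dock ⟨s(u, v), h⟩ u (Sym2.mem_mk_left u v)).adj, .inr ⟨_, _, rfl, rfl⟩⟩
    · exact ⟨_, (Rel.base u v hv h).adj, .inl ⟨h, rfl⟩⟩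
  · rintro v hv n (⟨-, rfl⟩ | ⟨⟨e, he⟩, hu, h, rfl⟩)
    · rfl
    · obtain rfl : e = s(u, v) := h
      exact hc u v he
  · rintro v n n' (⟨h, rfl⟩ | ⟨⟨e, he⟩, hu, h, rfl⟩) (⟨h', rfl⟩ | ⟨⟨e', he'⟩, hu', h', rfl⟩)
    · rfl
    · obtain rfl : e' = s(u, v) := h'
      exact absurd he' h
    · obtain rfl : e = s(u, v) := h
      exact absurd he h'
    · obtain rfl : e = s(u, v) := h
      obtain rfl : e' = s(u, v) := h'
      rfl

theorem bijOn_edgeColor_inner (hG : IsCubic G) (hC : IsEvenSubgraph C)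
    (hf : ∀ e, S.SuperedgeFits A e (c e) (p e) (f e)) (e : C.edgeSet) (a : S.W e)
    (ha : ∀ v, a ≠ S.pole e v) :
    Set.BijOn (edgeColor F c p rung f (.inner e a ha)) (S.graph.neighborSet (.inner e a ha))
      (f e a '' (S.H e).neighborSet a) := by
  obtain ⟨hs, hbij, hpole⟩ := hf e
  obtain ⟨v, hv, hav⟩ := hbij a ha
  -- A neighbor of `a` other than a pole is kept; a pole is replaced by the vertex attached at the
  -- corresponding semiedge.
  refine bijOn_of_rel (fun b n => (∃ hb, n = .inner e b hb) ∨
    ∃ u hu k, b = S.pole e ⟨u, hu⟩ ∧ a = S.semi e u hu k ∧ S.Attached e u k n)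
    hav.injOn.bijOn_image ?_ ?_ ?_ ?_
  · intro n hn
    rcases adj_inner hn with ⟨b, hb, h, rfl⟩ | ⟨u, hu, k, rfl, h⟩
    · exact ⟨b, h, .inl ⟨hb, rfl⟩⟩
    · exact ⟨_, (S.pole_adj_semi e u hu k).symm, .inr ⟨u, hu, k, rfl, rfl, h⟩⟩
  · intro b hb
    by_cases h : ∀ v, b ≠ S.pole e v
    · exact ⟨_, (Rel.inner e a b ha h hb).adj, .inl ⟨h, rfl⟩⟩
    · push Not at h
      obtain ⟨⟨u, hu⟩, rfl⟩ := h
      have hk := S.eq_semi_of_slot_eq (h := hb.symm) rfl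
      obtain ⟨n, hn⟩ := exists_attached hG hC hu (S.slot e ⟨u, hu⟩ ⟨a, hb.symm⟩)
      refine ⟨n, ?_, .inr ⟨u, hu, _, rfl, hk, hn⟩⟩
      have := hn.adj (hu := hu)
      simp only [semiVertex, ← hk] at this
      exact this
  · rintro b hb n (⟨hb', rfl⟩ | ⟨u, hu, k, rfl, rfl, h⟩)
    · exact edgeColor_inner_same
    · rw [h.edgeColor_eq hu, hs _ _ hb, hpole ⟨u, hu⟩ _ (S.pole_adj_semi e u hu k), slot_semi]
  · rintro b n n' (⟨hbn, rfl⟩ | ⟨u, hu, k, rfl, hk, h⟩) (⟨hb', rfl⟩ | ⟨u', hu', k', hb, hk', h'⟩)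
    · rfl
    · exact absurd hb (hbn _)
    · exact absurd rfl (hb' _)
    · obtain rfl : u = u' := by
        by_contra hne
        exact S.pole_ne e ⟨u, hu⟩ ⟨u', hu'⟩ (fun h => hne (congrArg Subtype.val h)) hb
      obtain rfl := S.semi_injective (hk.symm.trans hk')
      exact h.unique hG hC hu h'

theorem bijOn_edgeColor_extra (hG : IsCubic G) (hC : IsEvenSubgraph C)
    (hA : ∀ v, (A v).ncard = 3) (hpA : ∀ e : C.edgeSet, ∀ u ∈ e.1, p e u ∈ A u)
    (hp : ∀ (e e' : C.edgeSet) u, u ∈ e.1 → u ∈ e'.1 → e' ≠ e → S.kind u = .APrime →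
      p e u ≠ p e' u)
    (hrung : ∀ e : C.edgeSet, ∀ u ∈ e.1, rung u ∈ A u ∧ p e u ≠ rung u)
    (u : V) (hu : u ∈ C.support) (hk : S.kind u = .APrime) (k : Fin 2) :
    Set.BijOn (edgeColor F c p rung f (.extra u hu hk k)) (S.graph.neighborSet (.extra u hu hk k))
      (A u) := by
  obtain ⟨e, he⟩ := exists_edge_of_mem_support hu
  obtain ⟨e', hne, he', hall⟩ := exists_mate hG hC e he
  -- The three colors at `u'` and at `u''` are distinct elements of the 3-set `A u`, hence fill it.
  have hAu : A u = {p e u, p e' u, rung u} := by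
    symm
    refine Set.eq_of_subset_of_ncard_le ?_ ?_
    · rintro _ (rfl | rfl | rfl)
      exacts [hpA e u he, hpA e' u he', (hrung e u he).1]
    · rw [hA, Set.ncard_eq_three.2 ⟨_, _, _, hp e e' u he he' hne hk, (hrung e u he).2,
        (hrung e' u he').2, rfl⟩]
  obtain ⟨j, hj⟩ : ∃ j : Fin 2, j ≠ k := exists_ne k
  refine ⟨?_, ?_, ?_⟩
  · intro n hn
    rcases adj_extra hn with ⟨g, hg, rfl⟩ | ⟨i, hi, rfl⟩
    · exact hpA g u hg
    · exact (hrung e u he).1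
  · intro n hn n' hn' h
    rcases adj_extra hn with ⟨g, hg, rfl⟩ | ⟨i, hi, rfl⟩ <;>
      rcases adj_extra hn' with ⟨g', hg', rfl⟩ | ⟨i', hi', rfl⟩
    · by_cases hgg : g' = g
      · subst hgg; rfl
      · exact absurd h (hp g g' u hg hg' hgg hk)
    · exact absurd h (hrung g u hg).2
    · exact absurd h.symm (hrung g' u hg').2
    · have : i = i' := by omega
      rw [this]
  · rw [hAu]
    rintro _ (rfl | rfl | rfl)
    · exact ⟨_, (S.rel_spoke e u he hu hk k).adj, rfl⟩
    · exact ⟨_, (S.rel_spoke e' u he' hu hk k).adj, rfl⟩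
    · exact ⟨_, extra_adj_extra hj, rfl⟩

end EdgeColor

end SuperpositionData

/-! ### Degenerate ends and normality -/

namespace SuperpositionData

variable {V : Type*} {G : SimpleGraph V} {C : G.Subgraph} {S : SuperpositionData C}

theorem superedgeFits_of_colorable {A : V → Set (Fin 5)} {u v : V} (huv : u ≠ v)
    (he : s(u, v) ∈ C.edgeSet) {c : Fin 5} {p : V → Fin 5}
    (h : SuperedgeColorable (S.H ⟨s(u, v), he⟩) (S.pole ⟨s(u, v), he⟩ ⟨u, Sym2.mem_mk_left u v⟩)
      (S.pole ⟨s(u, v), he⟩ ⟨v, Sym2.mem_mk_right u v⟩) (S.semi ⟨s(u, v), he⟩ u (by simp) 0)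
      (S.semi ⟨s(u, v), he⟩ v (by simp) 0) (A u) (A v) c (p u) (p v)) :
    ∃ f, S.SuperedgeFits A ⟨s(u, v), he⟩ c p f := by
  obtain ⟨f, hs, hf, hu, hv⟩ := h
  have key : ∀ (w : V) (hw : w ∈ s(u, v)),
      IsPoleColoring (S.H ⟨s(u, v), he⟩) f (S.pole ⟨s(u, v), he⟩ ⟨w, hw⟩)
        (S.semi ⟨s(u, v), he⟩ w hw 0) c (p w) →
      ∀ (b : S.W ⟨s(u, v), he⟩) (h : (S.H ⟨s(u, v), he⟩).Adj (S.pole ⟨s(u, v), he⟩ ⟨w, hw⟩) b),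
      f (S.pole ⟨s(u, v), he⟩ ⟨w, hw⟩) b =
        if S.slot ⟨s(u, v), he⟩ ⟨w, hw⟩ ⟨b, h⟩ = 0 then c else p w := by
    intro w hw hpole b hb
    split_ifs with h0
    · exact (hpole b hb).1 (S.eq_semi_of_slot_eq (e := ⟨s(u, v), he⟩) h0)
    · refine (hpole b hb).2 fun h => h0 ?_
      subst h
      exact S.slot_semi ⟨s(u, v), he⟩ w hw 0
  refine ⟨f, hs, fun a ha => ?_, ?_⟩
  · rcases hf a (ha _) (ha _) with h | h
    · exact ⟨u, Sym2.mem_mk_left u v, h⟩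
    · exact ⟨v, Sym2.mem_mk_right u v, h⟩
  · rintro ⟨w, hw⟩
    rcases Sym2.mem_iff.1 hw with rfl | rfl
    · exact key w hw hu
    · exact key w hw hv

/-- For a suitable choice of the edges `e` and ends `v` of `e` where the semiedges get the color
of `e`, with `v` being the tail of `e`, the superedges have all required colorings. -/
theorem exists_degenerate_ends (hflower : ∀ e : C.edgeSet, IsFlowerSnark (S.H e))
    (hdist : ∀ (e : C.edgeSet) (u v : {v : V // v ∈ (e : Sym2 V)}), u ≠ v →
      3 ≤ (S.H e).dist (S.pole e u) (S.pole e v))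
    {A : V → Set (Fin 5)} (hA : ∀ v, (A v).ncard = 3) {c : C.edgeSet → Fin 5}
    (hc : ∀ e : C.edgeSet, ∀ v ∈ e.1, c e ∈ A v)
    (tail : C.edgeSet → V) (htail : ∀ e, tail e ∈ e.1) :
    ∃ Z : C.edgeSet → V → Prop, (∀ e v, Z e v → v = tail e) ∧
      ∀ (e : C.edgeSet) (p : V → Fin 5), (∀ v ∈ e.1, p v ∈ A v ∧ (p v = c e ↔ Z e v)) →
        ∃ f, S.SuperedgeFits A e (c e) p f := by
  have key : ∀ e : C.edgeSet, ∃ Z : V → Prop, (∀ v, Z v → v = tail e) ∧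
      ∀ p : V → Fin 5, (∀ v ∈ e.1, p v ∈ A v ∧ (p v = c e ↔ Z v)) →
        ∃ f, S.SuperedgeFits A e (c e) p f := by
    rintro ⟨e, he⟩
    obtain ⟨v, hv⟩ := Sym2.mem_iff_exists.1 (htail ⟨e, he⟩)
    set u := tail ⟨e, he⟩ with hu
    clear_value u
    dsimp only at hv
    subst hv
    have huv : u ≠ v := (C.adj_sub he).ne
    have hue : u ∈ s(u, v) := Sym2.mem_mk_left u v
    have hve : v ∈ s(u, v) := Sym2.mem_mk_right u v
    have hd := (hflower ⟨s(u, v), he⟩).dichotomy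
      (hdist ⟨s(u, v), he⟩ ⟨u, hue⟩ ⟨v, hve⟩ fun h => huv (congrArg Subtype.val h))
      (S.pole_adj_semi ⟨s(u, v), he⟩ u hue 0) (S.pole_adj_semi ⟨s(u, v), he⟩ v hve 0)
    -- The first pole is the one at the tail `u`, so in the degenerate case only the half with color
    -- `c` at the first pole is needed.
    rcases superedgeColorable_cases hd (hA u) (hA v) (hc ⟨s(u, v), he⟩ u hue)
      (hc ⟨s(u, v), he⟩ v hve) with h | ⟨h, -⟩
    · refine ⟨fun _ => False, fun _ => False.elim, fun p hp => ?_⟩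
      obtain ⟨hpu, hpu'⟩ := hp u hue
      obtain ⟨hpv, hpv'⟩ := hp v hve
      exact superedgeFits_of_colorable huv he (h _ hpu hpu'.1 _ hpv hpv'.1)
    · refine ⟨fun w => w = u, fun w hw => hw, fun p hp => ?_⟩
      obtain ⟨hpu, hpu'⟩ := hp u hue
      obtain ⟨hpv, hpv'⟩ := hp v hve
      refine superedgeFits_of_colorable huv he ?_
      rw [hpu'.2 rfl]
      exact h _ hpv fun h => huv (hpv'.1 h).symm
  choose Z hZ using key
  exact ⟨Z, fun e => (hZ e).1, fun e => (hZ e).2⟩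

/-- All edges but those through a supervertex `A` join vertices whose sets belong to equal or
adjacent vertices of `G`. An edge through `A` at `u` might join a vertex seeing the set of the far
end of `e` to one seeing the set of the far end of `e'`; as one of the two edges is not degenerate
at `u`, at least one of the sets is `A u`. -/
theorem vertexColors_normal {A : V → Set (Fin 5)} (hA : ∀ v, (A v).ncard = 3)
    (hn : ∀ u v, G.Adj u v → (A u ∪ A v).ncard = 3 ∨ (A u ∪ A v).ncard = 5)
    {c : C.edgeSet → Fin 5} (hc : ∀ e : C.edgeSet, ∀ v ∈ e.1, c e ∈ A v)
    {p : C.edgeSet → V → Fin 5} (hpA : ∀ e : C.edgeSet, ∀ u ∈ e.1, p e u ∈ A u)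
    (hp : ∀ (e e' : C.edgeSet) u, e ≠ e' → u ∈ e.1 → u ∈ e'.1 → p e u ≠ c e ∨ p e' u ≠ c e')
    {f : ∀ e, S.W e → S.W e → Fin 5} (hf : ∀ e, S.SuperedgeFits A e (c e) (p e) (f e))
    (m n : S.Vertex) (h : S.graph.Adj m n) :
    (vertexColors A f m ∪ vertexColors A f n).ncard = 3 ∨
      (vertexColors A f m ∪ vertexColors A f n).ncard = 5 := by
  have hn' : ∀ (e : C.edgeSet) u v, u ∈ e.1 → v ∈ e.1 →
      (A u ∪ A v).ncard = 3 ∨ (A u ∪ A v).ncard = 5 := by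
    intro e u v hu hv
    by_cases huv : u = v
    · subst huv; rw [Set.union_self]; exact .inl (hA u)
    · refine hn u v ?_
      have := C.edgeSet_subset e.2
      rwa [(Sym2.mem_and_mem_iff huv).1 ⟨hu, hv⟩] at this
  have hcol : ∀ (e : C.edgeSet) (a : S.W e), (∀ v, a ≠ S.pole e v) →
      ∃ v ∈ e.1, f e a '' (S.H e).neighborSet a = A v := by
    intro e a ha
    obtain ⟨v, hv, h⟩ := (hf e).2.1 a ha
    exact ⟨v, hv, h.image_eq⟩
  -- The semiedge has a color of `A u` different from `c e`. If its vertex saw a different set `A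
  -- v`, then `A u` and `A v` would share two colors.
  have hsemi : ∀ (e : C.edgeSet) (u : V) (hu : u ∈ e.1) (k : Fin 2), p e u ≠ c e →
      f e (S.semi e u hu k.succ) '' (S.H e).neighborSet (S.semi e u hu k.succ) = A u := by
    intro e u hu k hne
    obtain ⟨v, hv, h⟩ := hcol e _ (S.semi_ne_pole e u hu k.succ)
    have hadj := S.pole_adj_semi e u hu k.succ
    have hcolor : f e (S.semi e u hu k.succ) (S.pole e ⟨u, hu⟩) = p e u := by
      rw [← (hf e).1 _ _ hadj, (hf e).2.2 ⟨u, hu⟩ _ hadj, slot_semi, if_neg (Fin.succ_ne_zero _)]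
    have hmem : p e u ∈ A v := by
      rw [← h, ← hcolor]
      exact ⟨_, hadj.symm, rfl⟩
    rw [h]
    rcases eq_or_inter_eq_of_ncard_union (hA u) (hA v) (hn' e u v hu hv) with h | h
    · exact h.symm
    · exact absurd (h _ (hpA e u hu) hmem _ (hc e u hu) (hc e v hv)) hne
  have key : ∀ m n, Rel S m n → (vertexColors A f m ∪ vertexColors A f n).ncard = 3 ∨
      (vertexColors A f m ∪ vertexColors A f n).ncard = 5 := by
    intro m n h
    cases h with
    | base u v h hC => exact hn u v h
    | inner e a b ha hb h =>
      obtain ⟨u, hu, h1⟩ := hcol e a ha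
      obtain ⟨v, hv, h2⟩ := hcol e b hb
      simp only [vertexColors, h1, h2]
      exact hn' e u v hu hv
    | dock e u hu a ha h hs =>
      obtain ⟨v, hv, h1⟩ := hcol e a ha
      simp only [vertexColors, h1]
      exact hn' e u v hu hv
    | through e e' hee u hue hue' hk a b ha hb hadj hbdj k hsa hsb =>
      obtain rfl := S.eq_semi_of_slot_eq hsa
      obtain rfl := S.eq_semi_of_slot_eq hsb
      rcases hp e e' u hee hue hue' with h | h
      · obtain ⟨v, hv, h2⟩ := hcol e' _ hb
        simp only [vertexColors, hsemi e u hue k h, h2]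
        exact hn' e' u v hue' hv
      · obtain ⟨v, hv, h2⟩ := hcol e _ ha
        simp only [vertexColors, hsemi e' u hue' k h, h2]
        exact hn' e v u hv hue
    | spoke e u hu huC hk a ha h k hs =>
      obtain ⟨v, hv, h1⟩ := hcol e a ha
      simp only [vertexColors, h1]
      exact hn' e u v hu hv
    | rung u hu hk =>
      simp only [vertexColors, Set.union_self]
      exact .inl (hA u)
  obtain ⟨-, h | h⟩ := h
  · exact key m n h
  · rw [Set.union_comm]
    exact key n m h

end SuperpositionData

end NormalColoring

open NormalColoring SuperpositionData in
theorem mainTheorem1 {V : Type*} [Finite V] (G : SimpleGraph V)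
    (hG : NormalColoring.IsSnark G)
    (hσ : NormalColoring.HasNormalFiveEdgeColoring G)
    (C : G.Subgraph) (hC : NormalColoring.IsEvenSubgraph C)
    (S : NormalColoring.SuperpositionData C)
    (hflower : ∀ e : C.edgeSet, NormalColoring.IsFlowerSnark (S.H e))
    (hdist : ∀ (e : C.edgeSet) (u v : {v : V // v ∈ (e : Sym2 V)}), u ≠ v →
      3 ≤ (S.H e).dist (S.pole e u) (S.pole e v)) :
    NormalColoring.HasNormalFiveEdgeColoring S.graph ∧
      NormalColoring.HasPetersenColoring S.graph := by
  classical
  obtain ⟨σ, hσ⟩ := hσ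
  have hcub := hG.cubic
  have hA := ncard_colorsAt hcub σ
  let F : V → V → Fin 5 := fun u v => if h : G.Adj u v then σ ⟨s(u, v), h⟩ else 0
  have hF : ∀ u v (h : G.Adj u v), σ ⟨s(u, v), h⟩ = F u v := fun u v h => by
    simp only [F, dif_pos h]
  have hFs : ∀ u v, G.Adj u v → F u v = F v u := fun u v h => by
    rw [← hF u v h, ← hF v u h.symm]
    exact congrArg σ (Subtype.ext Sym2.eq_swap)
  let c : C.edgeSet → Fin 5 := fun e => σ ⟨e.1, C.edgeSet_subset e.2⟩
  have hc : ∀ e : C.edgeSet, ∀ v ∈ e.1, c e ∈ colorsAt σ v := fun e v hv => mem_colorsAt σ hv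
  have hcc : ∀ (e f : C.edgeSet) v, v ∈ e.1 → v ∈ f.1 → e ≠ f → c e ≠ c f :=
    fun e f v he hf hef h => hef (Subtype.ext
      (Subtype.mk.inj (lineGraph_coloring_injOn σ v he hf h)))
  obtain ⟨tail, htail, htail'⟩ := exists_tail hcub hC
  obtain ⟨Z, hZ, hfits⟩ := exists_degenerate_ends hflower hdist hA hc tail htail'
  -- Degenerate ends are tails, and different edges have different tails.
  have hZ' : ∀ e f v, e ≠ f → ¬ (Z e v ∧ Z f v) := fun e f v hef h =>
    hef (htail ((hZ e v h.1).symm.trans (hZ f v h.2)))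
  obtain ⟨p, hp⟩ := exists_connector_colors hcub hC hA hc hcc Z hZ' S.kind
  obtain ⟨rung, hrung⟩ := exists_rung_color hcub hC hA p
  -- The superedges are colored last: `Z` was fixed independently of `p`, and `p` meets it at both
  -- ends of every edge.
  choose f hf using fun e => hfits e (p e) fun v hv => ⟨(hp e v hv).1, (hp e v hv).2.1⟩
  have hpA : ∀ e : C.edgeSet, ∀ u ∈ e.1, p e u ∈ colorsAt σ u := fun e u hu => (hp e u hu).1
  have hbij : ∀ v, Set.BijOn (edgeColor F c p rung f v) (S.graph.neighborSet v)
      (vertexColors (colorsAt σ) f v) := by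
    rintro (u | ⟨e, a, ha⟩ | ⟨u, hu, hk, k⟩)
    · exact bijOn_edgeColor_base (bijOn_neighborSet σ F hF) (fun u v h => hF u v (C.adj_sub h)) u
    · exact bijOn_edgeColor_inner hcub hC hf e a ha
    · exact bijOn_edgeColor_extra hcub hC hA hpA
        (fun e e' u hu hu' hne => ((hp e u hu).2.2 e' hne hu').2) hrung u hu hk k
  refine coloring_of_stars (edgeColor F c p rung f) (vertexColors (colorsAt σ) f) ?_ hbij ?_ ?_
  · exact edgeColor_symm hFs (fun e e' u hu hu' hne => ((hp e u hu).2.2 e' hne hu').1) hf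
  · rintro (u | ⟨e, a, ha⟩ | ⟨u, hu, hk, k⟩)
    · exact hA u
    · obtain ⟨v, -, h⟩ := (hf e).2.1 a ha
      change (f e a '' _).ncard = 3
      rw [h.image_eq, hA]
    · exact hA u
  · refine vertexColors_normal hA hσ hc hpA (fun e e' u hne hu hu' => ?_) hf
    by_contra! h
    exact hZ' e e' u hne ⟨(hp e u hu).2.1.1 h.1, (hp e' u hu').2.1.1 h.2⟩
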